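/- Let $\widehat{\mathbb C}=\mathbb C\cup\{\infty\}$ be the Riemann sphere with half the chordal distance $\chi(z,w)=\frac{|z-w|}{\sqrt{1+|z|^2}\sqrt{1+|w|^2}}$, $\chi(z,\infty)=\frac1{\sqrt{1+|z|^2}}$, and let $\mathbb D$ be the open unit disc. Riemann surfaces are connected. For a Riemann surface $\Sigma$ let $\mathscr M(\Sigma)$ be the set of holomorphic maps $\Sigma\to\widehat{\mathbb C}$, with the topology of uniform convergence on compact subsets with respect to $\chi$. A property $P$ of $\widehat{\mathbb C}$-valued holomorphic maps assigns to each Riemann surface $\Sigma$ the set $\mathscr P(\Sigma)\subset\mathscr M(\Sigma)$ of the maps that satisfy it. It is called compact if (P1) for every holomorphic map $\phi:\Sigma\to\Sigma'$ of Riemann surfaces without ramification points, $f\in\mathscr P(\Sigma')$ implies $f\circ\phi\in\mathscr P(\Sigma)$; (P2) if $f\in\mathscr M(\Sigma)$ and $f|_\Omega\in\mathscr P(\Omega)$ for every relatively compact domain $\Omega$ of $\Sigma$, then $f\in\mathscr P(\Sigma)$; (P3) $\mathscr P(\Sigma)$ is closed in $\mathscr M(\Sigma)$ for every Riemann surface $\Sigma$;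 (P4) for every Riemann surface $\Sigma$ the family $\mathscr P(\Sigma)$ is normal, that is, every sequence in it has a subsequence that converges, uniformly on compact subsets with respect to $\chi$, to some function $\Sigma\to\widehat{\mathbb C}$. Let $P$ be a compact property. If $f\in\mathscr P(\mathbb D\setminus\{0\})$, then $0$ is not an essential singularity of $f$ (that is, $f$ has a limit in $\widehat{\mathbb C}$ at $0$), and $f$ extends to a holomorphic map $\mathbb D\to\widehat{\mathbb C}$. Moreover, the same conclusion holds for the property $P_X$ of omitting every point of $X$ or being constant, for every $X\subset\widehat{\mathbb C}$ with $|X|\ge 3$ (the contrapositive of the great Picard theorem): if a holomorphic map $f:\mathbb D\setminus\{0\}\to\widehat{\mathbb C}$ is constant or omits every point of $X$, then $0$ is not an essential singularity of $f$, and $f$ extends to a holomorphic map $\mathbb D\to\widehat{\mathbb C}$. -/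

import Mathlib

open Set Filter Topology TopologicalSpace
open scoped Manifold ContDiff

noncomputable section

namespace BlochRos

/-! ### The Riemann sphere as a complex manifold -/

/-- The extended complex plane `ℂ ∪ {∞}`, with the topology of the one-point compactification. -/
abbrev Sphere : Type := OnePoint ℂ

/-- The coordinate `z` on `ℂ ⊂ ℂ ∪ {∞}` (with junk value `0` at `∞`). -/
def finitePart (p : Sphere) : ℂ := p.elim 0 id

/-- The map `w ↦ 1 / w` from `ℂ` to `ℂ ∪ {∞}`, with `1 / 0 = ∞`. -/
def invToSphere (w : ℂ) : Sphere := if w = 0 then OnePoint.infty else ((w⁻¹ : ℂ) : Sphere)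

/-- The coordinate `1 / z` on `(ℂ ∪ {∞}) \ {0}`, with `1 / ∞ = 0`. -/
def invFinitePart (p : Sphere) : ℂ := p.elim 0 fun z => z⁻¹

@[simp] theorem finitePart_coe (z : ℂ) : finitePart (z : Sphere) = z := rfl

@[simp] theorem finitePart_infty : finitePart OnePoint.infty = 0 := rfl

@[simp] theorem invFinitePart_coe (z : ℂ) : invFinitePart (z : Sphere) = z⁻¹ := rfl

@[simp] theorem invFinitePart_infty : invFinitePart OnePoint.infty = 0 := rfl

@[simp] theorem invToSphere_zero : invToSphere 0 = OnePoint.infty := by simp [invToSphere]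

theorem invToSphere_of_ne {w : ℂ} (hw : w ≠ 0) : invToSphere w = ((w⁻¹ : ℂ) : Sphere) := by
  simp [invToSphere, hw]

theorem continuous_invToSphere : Continuous invToSphere := by
  rw [continuous_iff_continuousAt]
  intro w
  by_cases hw : w = 0
  · subst hw
    rw [continuousAt_iff_punctured_nhds, invToSphere_zero]
    have h1 : Tendsto (fun w : ℂ => ((w⁻¹ : ℂ) : Sphere)) (𝓝[≠] 0) (𝓝 OnePoint.infty) := by
      refine OnePoint.tendsto_coe_infty.comp ?_
      rw [coclosedCompact_eq_cocompact, ← Metric.cobounded_eq_cocompact]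
      exact tendsto_inv₀_nhdsNE_zero
    refine h1.congr' ?_
    filter_upwards [self_mem_nhdsWithin] with w hw
    exact (invToSphere_of_ne hw).symm
  · have h1 : ContinuousAt (fun w : ℂ => ((w⁻¹ : ℂ) : Sphere)) w :=
      OnePoint.continuous_coe.continuousAt.comp (continuousAt_inv₀ hw)
    refine h1.congr ?_
    filter_upwards [isOpen_ne.mem_nhds hw] with w hw
    exact (invToSphere_of_ne hw).symm

/-- The chart `z` of the Riemann sphere, defined on the complement of `∞`. -/
def finiteChart : OpenPartialHomeomorph Sphere ℂ where
  toFun := finitePart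
  invFun := fun z => (z : Sphere)
  source := {OnePoint.infty}ᶜ
  target := univ
  map_source' _ _ := mem_univ _
  map_target' z _ := OnePoint.coe_ne_infty z
  left_inv' p hp := by
    induction p using OnePoint.rec with
    | infty => exact absurd rfl hp
    | coe z => rfl
  right_inv' _ _ := rfl
  open_source := OnePoint.isClosed_infty.isOpen_compl
  open_target := isOpen_univ
  continuousOn_toFun := by
    intro p hp
    induction p using OnePoint.rec with
    | infty => exact absurd rfl hp
    | coe z =>
      refine ContinuousAt.continuousWithinAt ?_
      rw [OnePoint.continuousAt_coe]
      exact continuousAt_id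
  continuousOn_invFun := OnePoint.continuous_coe.continuousOn

/-- The chart `1 / z` of the Riemann sphere, defined on the complement of `0`. -/
def infinityChart : OpenPartialHomeomorph Sphere ℂ where
  toFun := invFinitePart
  invFun := invToSphere
  source := {((0 : ℂ) : Sphere)}ᶜ
  target := univ
  map_source' _ _ := mem_univ _
  map_target' w _ := by
    by_cases hw : w = 0
    · subst hw; simp
    · rw [invToSphere_of_ne hw]
      simpa using hw
  left_inv' p hp := by
    induction p using OnePoint.rec with
    | infty => simp
    | coe z =>
      have hz : z ≠ 0 := fun h => hp (by simp [h])
      rw [invFinitePart_coe, invToSphere_of_ne (inv_ne_zero hz), inv_inv]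
  right_inv' w _ := by
    by_cases hw : w = 0
    · subst hw; simp
    · rw [invToSphere_of_ne hw, invFinitePart_coe, inv_inv]
  open_source := isClosed_singleton.isOpen_compl
  open_target := isOpen_univ
  continuousOn_toFun := by
    intro p hp
    refine ContinuousAt.continuousWithinAt ?_
    induction p using OnePoint.rec with
    | infty =>
      rw [OnePoint.continuousAt_infty', coclosedCompact_eq_cocompact,
        ← Metric.cobounded_eq_cocompact]
      exact tendsto_inv₀_cobounded
    | coe z =>
      have hz : z ≠ 0 := fun h => hp (by simp [h])
      rw [OnePoint.continuousAt_coe]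
      exact continuousAt_inv₀ hz
  continuousOn_invFun := continuous_invToSphere.continuousOn

@[simp] theorem finiteChart_apply (p : Sphere) : finiteChart p = finitePart p := rfl

@[simp] theorem finiteChart_symm_apply (z : ℂ) : finiteChart.symm z = (z : Sphere) := rfl

@[simp] theorem finiteChart_source : finiteChart.source = {OnePoint.infty}ᶜ := rfl

@[simp] theorem finiteChart_target : finiteChart.target = univ := rfl

@[simp] theorem infinityChart_apply (p : Sphere) : infinityChart p = invFinitePart p := rfl

@[simp] theorem infinityChart_symm_apply (w : ℂ) : infinityChart.symm w = invToSphere w := rfl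

@[simp] theorem infinityChart_source : infinityChart.source = {((0 : ℂ) : Sphere)}ᶜ := rfl

@[simp] theorem infinityChart_target : infinityChart.target = univ := rfl

open Classical in
/-- The Riemann sphere with its two standard charts `z` and `1 / z`. -/
instance : ChartedSpace ℂ Sphere where
  atlas := {finiteChart, infinityChart}
  chartAt p := if p = OnePoint.infty then infinityChart else finiteChart
  mem_chart_source p := by
    by_cases hp : p = OnePoint.infty
    · subst hp
      simp
    · simp [hp]
  chart_mem_atlas p := by
    by_cases hp : p = OnePoint.infty <;> simp [hp]

/-- The coordinate changes `z ↦ 1 / z` are holomorphic. -/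
instance : IsManifold 𝓘(ℂ) ω Sphere := by
  refine isManifold_of_contDiffOn _ _ _ ?_
  have key : ∀ e : OpenPartialHomeomorph Sphere ℂ, ContDiffOn ℂ ω (e.symm ≫ₕ e)
      (e.symm ≫ₕ e).source := by
    intro e
    refine contDiffOn_id.congr fun w hw => ?_
    simp only [OpenPartialHomeomorph.trans_source, OpenPartialHomeomorph.symm_source,
      mem_inter_iff] at hw
    exact e.right_inv hw.1
  have inv : ∀ s : Set ℂ, (0 : ℂ) ∉ s → ContDiffOn ℂ ω (fun z : ℂ => z⁻¹) s := fun s hs z hz =>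
    (contDiffAt_inv ℂ fun h => hs (h ▸ hz)).contDiffWithinAt
  rintro e e' (rfl | rfl) (rfl | rfl)
  · simpa using key finiteChart
  · have h0 : (0 : ℂ) ∉ (finiteChart.symm ≫ₕ infinityChart).source := by
      simp
    refine ContDiffOn.congr (f := fun z : ℂ => z⁻¹) (by simpa using inv _ h0) ?_
    intro z _
    simp
  · have h0 : (0 : ℂ) ∉ (infinityChart.symm ≫ₕ finiteChart).source := by
      simp
    refine ContDiffOn.congr (f := fun z : ℂ => z⁻¹) (by simpa using inv _ h0) ?_
    intro z hz
    have hz' : z ≠ 0 := by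
      rintro rfl
      simp at hz
    simp [invToSphere_of_ne hz']
  · simpa using key infinityChart

/-- Half of the chordal distance on the Riemann sphere. -/
def chi : Sphere → Sphere → ℝ
  | OnePoint.infty, OnePoint.infty => 0
  | OnePoint.infty, OnePoint.some w => 1 / √(1 + ‖w‖ ^ 2)
  | OnePoint.some z, OnePoint.infty => 1 / √(1 + ‖z‖ ^ 2)
  | OnePoint.some z, OnePoint.some w => ‖z - w‖ / (√(1 + ‖z‖ ^ 2) * √(1 + ‖w‖ ^ 2))

/-! ### Riemann surfaces and holomorphic maps into the sphere -/

/-- Connected Riemann surfaces: connected, Hausdorff, second countable complex manifolds of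
dimension one. -/
class IsRiemannSurface (S : Type) [TopologicalSpace S] [ChartedSpace ℂ S] : Prop
    extends IsManifold 𝓘(ℂ) ω S, T2Space S, SecondCountableTopology S, ConnectedSpace S

/-- Every domain of a Riemann surface is a Riemann surface. -/
instance {S : Type} [TopologicalSpace S] [ChartedSpace ℂ S] [IsRiemannSurface S]
    (U : Opens S) [ConnectedSpace U] : IsRiemannSurface U where

instance : IsRiemannSurface ℂ where

/-- The set of holomorphic maps from `S` to the Riemann sphere. -/
def HolMap (S : Type) [TopologicalSpace S] [ChartedSpace ℂ S] : Type :=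
  {f : S → Sphere // MDifferentiable 𝓘(ℂ) 𝓘(ℂ) f}

instance (S : Type) [TopologicalSpace S] [ChartedSpace ℂ S] :
    CoeFun (HolMap S) fun _ => S → Sphere := ⟨fun f => f.1⟩

/-- Composition of a holomorphic map into the sphere with a holomorphic map of surfaces. -/
def HolMap.comp {S S' : Type} [TopologicalSpace S] [ChartedSpace ℂ S] [TopologicalSpace S']
    [ChartedSpace ℂ S'] (f : HolMap S') (φ : S → S') (hφ : MDifferentiable 𝓘(ℂ) 𝓘(ℂ) φ) :
    HolMap S :=
  ⟨f.1 ∘ φ, f.2.comp hφ⟩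

/-- Restriction of a holomorphic map to an open subset. -/
def HolMap.restrict {S : Type} [TopologicalSpace S] [ChartedSpace ℂ S] (f : HolMap S)
    (U : Opens S) : HolMap U :=
  f.comp (Subtype.val : U → S)
    ((contMDiff_subtype_val (I := 𝓘(ℂ)) (n := 1)).mdifferentiable one_ne_zero)

/-- The topology of uniform convergence on compact subsets, with respect to `chi`. -/
instance (S : Type) [TopologicalSpace S] [ChartedSpace ℂ S] : TopologicalSpace (HolMap S) where
  IsOpen V := ∀ f ∈ V, ∃ K : Set S, IsCompact K ∧ ∃ ε > (0 : ℝ),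
    ∀ g : HolMap S, (∀ p ∈ K, chi (g p) (f p) < ε) → g ∈ V
  isOpen_univ _ _ := ⟨∅, isCompact_empty, 1, one_pos, fun _ _ => mem_univ _⟩
  isOpen_inter V W hV hW f hf := by
    obtain ⟨K, hK, ε, hε, h⟩ := hV f hf.1
    obtain ⟨L, hL, δ, hδ, h'⟩ := hW f hf.2
    exact ⟨K ∪ L, hK.union hL, min ε δ, lt_min hε hδ, fun g hg =>
      ⟨h g fun p hp => (hg p (Or.inl hp)).trans_le (min_le_left _ _),
        h' g fun p hp => (hg p (Or.inr hp)).trans_le (min_le_right _ _)⟩⟩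
  isOpen_sUnion 𝒱 h𝒱 f hf := by
    obtain ⟨V, hV, hfV⟩ := hf
    obtain ⟨K, hK, ε, hε, h⟩ := h𝒱 V hV f hfV
    exact ⟨K, hK, ε, hε, fun g hg => ⟨V, hV, h g hg⟩⟩

/-- Spherically uniform convergence on compact subsets. -/
def SphLocTendsto {S : Type} [TopologicalSpace S] (f : ℕ → S → Sphere) (g : S → Sphere) : Prop :=
  ∀ K : Set S, IsCompact K → ∀ ε > (0 : ℝ), ∃ N : ℕ, ∀ n ≥ N, ∀ p ∈ K, chi (f n p) (g p) < ε

/-- A family is normal if each of its sequences has a subsequence that converges spherically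
uniformly on compact subsets. -/
def IsNormalFamily {S : Type} [TopologicalSpace S] [ChartedSpace ℂ S] (F : Set (HolMap S)) :
    Prop :=
  ∀ f : ℕ → HolMap S, (∀ n, f n ∈ F) →
    ∃ (k : ℕ → ℕ) (g : S → Sphere), StrictMono k ∧ SphLocTendsto (fun n => f (k n)) g

/-! ### Compact properties -/

/-- A property of holomorphic maps from Riemann surfaces to the Riemann sphere, given by the set
`P S` of all holomorphic maps on `S` that satisfy it. -/
abbrev SphereProperty : Type 1 :=
  ∀ (S : Type) [TopologicalSpace S] [ChartedSpace ℂ S] [IsRiemannSurface S], Set (HolMap S)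

/-- Closed properties. A holomorphic map has no ramification point when its derivative vanishes
nowhere. -/
structure IsClosedProperty (P : SphereProperty) : Prop where
  comp_mem : ∀ (S S' : Type) [TopologicalSpace S] [ChartedSpace ℂ S] [IsRiemannSurface S]
    [TopologicalSpace S'] [ChartedSpace ℂ S'] [IsRiemannSurface S'] (φ : S → S')
    (hφ : MDifferentiable 𝓘(ℂ) 𝓘(ℂ) φ), (∀ p, mfderiv 𝓘(ℂ) 𝓘(ℂ) φ p ≠ 0) →
    ∀ f ∈ P S', f.comp φ hφ ∈ P S
  mem_of_restrict : ∀ (S : Type) [TopologicalSpace S] [ChartedSpace ℂ S] [IsRiemannSurface S]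
    (f : HolMap S), (∀ (U : Opens S) [ConnectedSpace U], IsCompact (closure (U : Set S)) →
      f.restrict U ∈ P U) → f ∈ P S
  isClosed : ∀ (S : Type) [TopologicalSpace S] [ChartedSpace ℂ S] [IsRiemannSurface S],
    IsClosed (P S)

/-- Compact properties: closed properties that define a normal family on each Riemann surface. -/
structure IsCompactProperty (P : SphereProperty) : Prop extends IsClosedProperty P where
  normal : ∀ (S : Type) [TopologicalSpace S] [ChartedSpace ℂ S] [IsRiemannSurface S],
    IsNormalFamily (P S)

/-- The property of omitting all points of `X` or being constant. -/
def omitProperty (X : Set Sphere) : SphereProperty := fun _ _ _ _ =>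
  {f | (∀ p, f p ∉ X) ∨ ∃ c, ∀ p, f p = c}

/-! ### The punctured disc -/

/-- The open unit disc. -/
def disc : Opens ℂ := ⟨Metric.ball 0 1, Metric.isOpen_ball⟩

/-- The open unit disc without its centre. -/
def puncturedDisc : Opens ℂ :=
  ⟨Metric.ball 0 1 \ {0}, Metric.isOpen_ball.sdiff isClosed_singleton⟩

theorem puncturedDisc_le_disc : puncturedDisc ≤ disc := fun _ h => h.1

instance : ConnectedSpace puncturedDisc := by
  have hc : IsConnected (Complex.exp '' {w : ℂ | w.re < 0}) :=
    ⟨⟨_, -1, by simp, rfl⟩, ((convex_halfSpace_re_lt 0).isPreconnected).image _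
      Complex.continuous_exp.continuousOn⟩
  refine isConnected_iff_connectedSpace.1 (?_ : IsConnected (puncturedDisc : Set ℂ))
  convert hc using 1
  ext z
  constructor
  · rintro ⟨h1, h2⟩
    have hz : z ≠ 0 := h2
    refine ⟨Complex.log z, ?_, Complex.exp_log hz⟩
    have h3 : ‖z‖ < 1 := by simpa using h1
    simpa [Complex.log_re] using Real.log_neg (norm_pos_iff.2 hz) h3
  · rintro ⟨w, hw, rfl⟩
    refine ⟨?_, Complex.exp_ne_zero w⟩
    simpa [Complex.norm_exp] using hw

/-- The puncture `0` is an essential singularity of `f` if `f` has no limit in `ℂ ∪ {∞}` there. -/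
def HasEssentialSingularity (f : HolMap puncturedDisc) : Prop :=
  ¬ ∃ a : Sphere, Tendsto f (comap (Subtype.val : puncturedDisc → ℂ) (𝓝[≠] 0)) (𝓝 a)

/-- `f` is the restriction of a holomorphic map from the whole disc to the Riemann sphere. -/
def ExtendsToDisc (f : HolMap puncturedDisc) : Prop :=
  ∃ F : HolMap disc, ∀ z : puncturedDisc, F (Opens.inclusion puncturedDisc_le_disc z) = f z

end BlochRos

end

/-!
A holomorphic map `f` from the punctured disc to the sphere extends across `0` as soon as it has a
limit there (`extends_of_tendsto`, by removability of the singularity in the chart `z` or `1 / z`).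
The limit is obtained in two different ways.

For a compact property, composing `f` with the unramified maps `ζ ↦ exp (w + R ζ)` from the unit
disc to the punctured disc, where `R ≤ -Re w` is large, gives members of the family attached to
the unit disc. That family is normal, hence equicontinuous at `0`; as every point of the circle
through `exp w` is the image of some `ζ` with `|ζ| ≤ π / R`, the oscillation of `f` on the circle
`|z| = r` tends to `0` with `r` (`exists_circle_oscillation_lt`). Small oscillation on circles
forces a limit (`exists_tendsto_of_circle_oscillation`): otherwise there are a finite cluster
value `a`, a `δ > 0` and an annulus on which `f` is finite, with values close to `a` on one
boundary circle, values close to some `c` with `|c - a| = δ / 2` on the other, and some value at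
distance exactly `δ / 4` from `a` in between, which contradicts the maximum principle for `(f - a)
(f - c)`.

For maps omitting three values, a Möbius transformation reduces to a holomorphic function `f`
omitting `0` and `1`. Such a function on a disc has the form `(1 + cos (π cos G)) / 2`, where the
image of `G` contains no large disc; Bloch's theorem bounds `G'` and yields Schottky's theorem
(`schottky`). If `f` does not tend to `∞` at `0`, it is bounded by a fixed constant at a sequence
of points tending to `0`, therefore, by Schottky's theorem for `f ∘ exp`, on the circles through
these points, and by the maximum principle near `0`.
-/

namespace BlochRos
section OmittedValues

open Complex Metric

/-! ### Bloch's and Schottky's theorems -/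

theorem exists_exp_eq_on_ball {c : ℂ} {R : ℝ} (hR : 0 < R) {f : ℂ → ℂ}
    (hf : DifferentiableOn ℂ f (ball c R)) (h0 : ∀ z ∈ ball c R, f z ≠ 0) :
    ∃ g : ℂ → ℂ, DifferentiableOn ℂ g (ball c R) ∧ ∀ z ∈ ball c R, exp (g z) = f z := by
  have hc : c ∈ ball c R := mem_ball_self hR
  have hdf : DifferentiableOn ℂ (fun z => deriv f z / f z) (ball c R) :=
    (hf.deriv isOpen_ball).div hf h0
  obtain ⟨g, hgc, hg⟩ := hdf.isExactOn_ball.with_val_at c (log (f c))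
  refine ⟨g, fun z hz => (hg z hz).differentiableAt.differentiableWithinAt, fun z hz => ?_⟩
  have hfd : ∀ w ∈ ball c R, HasDerivAt f (deriv f w) w := fun w hw =>
    ((hf w hw).differentiableAt (isOpen_ball.mem_nhds hw)).hasDerivAt
  have hq : ∀ w ∈ ball c R, HasDerivAt (fun w => f w * exp (-g w)) 0 w := by
    intro w hw
    refine ((hfd w hw).fun_mul ((hg w hw).fun_neg.cexp)).congr_deriv ?_
    have := h0 w hw
    field_simp
    ring
  have hconst : f z * exp (-g z) = f c * exp (-g c) :=
    (convex_ball c R).is_const_of_fderivWithin_eq_zero (𝕜 := ℂ)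
      (fun w hw => (hq w hw).differentiableAt.differentiableWithinAt)
      (fun w hw => by
        rw [fderivWithin_of_isOpen isOpen_ball hw, (hq w hw).hasFDerivAt.fderiv]
        ext; simp) hz hc
  rw [hgc, exp_neg (log _), exp_log (h0 c hc), mul_inv_cancel₀ (h0 c hc), exp_neg] at hconst
  field_simp [exp_ne_zero] at hconst
  exact hconst.symm

theorem abs_im_le_norm_cos (v : ℂ) : |v.im| ≤ ‖cos v‖ := by
  have h1 : ‖cos v‖ ^ 2 = Real.cos v.re ^ 2 + Real.sinh v.im ^ 2 := by
    have h : cos v = ((Real.cos v.re * Real.cosh v.im : ℝ) : ℂ)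
        + ((-(Real.sin v.re * Real.sinh v.im) : ℝ) : ℂ) * I := by
      conv_lhs => rw [Complex.cos_eq v]
      push_cast
      ring
    rw [h, ← normSq_eq_norm_sq, normSq_add_mul_I]
    have h2 := Real.sin_sq_add_cos_sq v.re
    have h3 := Real.cosh_sq v.im
    have h4 : Real.sin v.re ^ 2 = 1 - Real.cos v.re ^ 2 := by linarith
    rw [neg_sq, mul_pow, mul_pow, h3, h4]
    ring
  have h2 : |v.im| ≤ |Real.sinh v.im| := by
    rw [Real.abs_sinh]
    exact Real.self_le_sinh_iff.2 (abs_nonneg _)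
  refine h2.trans (abs_le_of_sq_le_sq ?_ (norm_nonneg _))
  rw [h1]
  nlinarith [sq_nonneg (Real.cos v.re)]

/-- A holomorphic function on a disc that omits `1` and `-1` is the cosine of a holomorphic
function, since `f + i √(1 - f ^ 2)` is a nonvanishing function, hence an exponential. Shifting by
a multiple of `2π` bounds the value at the centre in terms of `f` alone. -/
theorem exists_cos_eq_on_ball {c : ℂ} {R : ℝ} (hR : 0 < R) {f : ℂ → ℂ}
    (hf : DifferentiableOn ℂ f (ball c R)) (h1 : ∀ z ∈ ball c R, f z ≠ 1)
    (h2 : ∀ z ∈ ball c R, f z ≠ -1) :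
    ∃ g : ℂ → ℂ, DifferentiableOn ℂ g (ball c R) ∧ (∀ z ∈ ball c R, cos (g z) = f z) ∧
      ‖g c‖ ≤ 4 + ‖f c‖ := by
  obtain ⟨l, hl, hle⟩ := exists_exp_eq_on_ball hR (f := fun z => 1 - f z ^ 2)
    ((differentiableOn_const _).sub (hf.pow 2)) (fun z hz h => by
      have : (1 - f z) * (1 + f z) = 0 := by linear_combination h
      rcases mul_eq_zero.1 this with h | h
      · exact h1 z hz (by linear_combination -h)
      · exact h2 z hz (by linear_combination h))
  have hs : ∀ z ∈ ball c R, exp (l z / 2) ^ 2 = 1 - f z ^ 2 := fun z hz => by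
    rw [← hle z hz, ← exp_nat_mul]; congr 1; push_cast; ring
  obtain ⟨k, hk, hke⟩ := exists_exp_eq_on_ball hR (f := fun z => f z + I * exp (l z / 2))
    (hf.add ((hl.div_const 2).cexp.const_mul I)) (fun z hz h => by
      have h3 : (f z + I * exp (l z / 2)) * (f z - I * exp (l z / 2)) = 1 := by
        linear_combination hs z hz - exp (l z / 2) ^ 2 * I_sq
      rw [h, zero_mul] at h3
      exact zero_ne_one h3)
  have hcos : ∀ z ∈ ball c R, cos (-I * k z) = f z := fun z hz => by
    have h3 : (f z + I * exp (l z / 2)) * (f z - I * exp (l z / 2)) = 1 := by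
      linear_combination hs z hz - exp (l z / 2) ^ 2 * I_sq
    have h4 : exp (-k z) = f z - I * exp (l z / 2) := by
      rw [exp_neg, hke z hz]
      exact (eq_inv_of_mul_eq_one_right h3).symm
    rw [cos, show -I * k z * I = k z by linear_combination -k z * I_sq,
      show -(-I * k z) * I = -k z by linear_combination k z * I_sq, h4, hke z hz]
    ring
  obtain ⟨n, hn⟩ : ∃ n : ℤ, |(-I * k c).re - n * (2 * Real.pi)| ≤ Real.pi := by
    refine ⟨round ((-I * k c).re / (2 * Real.pi)), ?_⟩
    have h := abs_sub_round ((-I * k c).re / (2 * Real.pi))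
    have hp := Real.pi_pos
    have e : (-I * k c).re - round ((-I * k c).re / (2 * Real.pi)) * (2 * Real.pi)
        = ((-I * k c).re / (2 * Real.pi) - round ((-I * k c).re / (2 * Real.pi)))
          * (2 * Real.pi) := by field_simp
    rw [e, abs_mul, abs_of_pos (by positivity : 0 < 2 * Real.pi)]
    nlinarith
  refine ⟨fun z => -I * k z - n * (2 * Real.pi), (hk.const_mul _).sub_const _, fun z hz => ?_, ?_⟩
  · rw [cos_sub_int_mul_two_pi, hcos z hz]
  · have hc := mem_ball_self (x := c) hR
    set v := -I * k c - n * (2 * Real.pi) with hv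
    have hvc : cos v = f c := by rw [hv, cos_sub_int_mul_two_pi, hcos c hc]
    have hre : v.re = (-I * k c).re - n * (2 * Real.pi) := by
      rw [hv, sub_re]; congr 1
      rw [show (n : ℂ) * (2 * Real.pi) = ((n * (2 * Real.pi) : ℝ) : ℂ) by push_cast; ring,
        ofReal_re]
    have h3 := abs_im_le_norm_cos v
    rw [hvc] at h3
    have h4 := Complex.norm_le_abs_re_add_abs_im v
    rw [hre] at h4
    linarith [Real.pi_lt_four]

/-- The points at which the cosine is an integer form a relatively dense subset of the plane. -/
theorem exists_cos_eq_int_near (w : ℂ) : ∃ v : ℂ, ‖v - w‖ ≤ 6 ∧ ∃ n : ℤ, cos v = n := by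
  have hp := Real.pi_pos
  obtain ⟨m, hm⟩ : ∃ m : ℤ, |m * (2 * Real.pi) - w.re| ≤ Real.pi := by
    refine ⟨round (w.re / (2 * Real.pi)), ?_⟩
    have h := abs_sub_round (w.re / (2 * Real.pi))
    have e : w.re - round (w.re / (2 * Real.pi)) * (2 * Real.pi)
        = (w.re / (2 * Real.pi) - round (w.re / (2 * Real.pi))) * (2 * Real.pi) := by
      field_simp
    rw [abs_sub_comm, e, abs_mul, abs_of_pos (by positivity : 0 < 2 * Real.pi)]
    nlinarith
  have key : ∀ b : ℝ, 0 ≤ b → ∃ y : ℝ, |y - b| ≤ 2 ∧ ∃ n : ℤ, Real.cosh y = n := by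
    intro b hb
    set n := ⌊Real.cosh b⌋ with hn
    have hn1 : (1 : ℤ) ≤ n := Int.le_floor.2 (by simp)
    have hn1' : (1 : ℝ) ≤ n := by exact_mod_cast hn1
    obtain ⟨y, ⟨hy0, hyb⟩, hy⟩ := intermediate_value_Icc hb Real.continuous_cosh.continuousOn
      (show (n : ℝ) ∈ Icc (Real.cosh 0) (Real.cosh b) from
        ⟨by simpa using hn1', Int.floor_le _⟩)
    refine ⟨y, ?_, n, hy⟩
    rw [abs_sub_comm, abs_of_nonneg (by linarith)]
    by_contra! hlt
    have h1 : Real.cosh (y + 2) < Real.cosh b := Real.cosh_lt_cosh.2 (by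
      rw [abs_of_nonneg (by linarith), abs_of_nonneg hb]; linarith)
    have h2 : Real.cosh b < n + 1 := Int.lt_floor_add_one _
    have h3 : 2 ≤ Real.cosh 2 := by
      rw [Real.cosh_eq]
      have h4 := Real.quadratic_le_exp_of_nonneg (x := 2) (by norm_num)
      have h5 := Real.exp_pos (-2)
      linarith
    have h6 : 0 ≤ Real.sinh y * Real.sinh 2 :=
      mul_nonneg (Real.sinh_nonneg_iff.2 hy0) (Real.sinh_nonneg_iff.2 (by norm_num))
    rw [Real.cosh_add, hy] at h1
    nlinarith
  obtain ⟨y, hy, n, hyn⟩ : ∃ y : ℝ, |y - w.im| ≤ 2 ∧ ∃ n : ℤ, Real.cosh y = n := by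
    rcases le_total 0 w.im with hb | hb
    · exact key _ hb
    · obtain ⟨y, hy, n, hn⟩ := key (-w.im) (by linarith)
      refine ⟨-y, ?_, n, by rwa [Real.cosh_neg]⟩
      rw [← abs_neg]
      convert! hy using 2
      ring
  refine ⟨m * (2 * Real.pi) + y * I, ?_, n, ?_⟩
  · refine (Complex.norm_le_abs_re_add_abs_im _).trans ?_
    have h1 : ((m * (2 * Real.pi) + y * I : ℂ) - w).re = m * (2 * Real.pi) - w.re := by
      rw [show (m * (2 * Real.pi) + y * I : ℂ) = ((m * (2 * Real.pi) : ℝ) : ℂ) + y * I by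
        push_cast; ring]
      simp only [sub_re, add_re, ofReal_re, mul_re, I_re, I_im, ofReal_im]; ring
    have h2 : ((m * (2 * Real.pi) + y * I : ℂ) - w).im = y - w.im := by
      rw [show (m * (2 * Real.pi) + y * I : ℂ) = ((m * (2 * Real.pi) : ℝ) : ℂ) + y * I by
        push_cast; ring]
      simp only [sub_im, add_im, ofReal_re, mul_im, I_re, I_im, ofReal_im]; ring
    rw [h1, h2]
    linarith [Real.pi_lt_four]
  · rw [add_comm, cos_add_int_mul_two_pi, cos_mul_I, ← ofReal_cosh, hyn]
    simp

/-- A form of Bloch's theorem: if every disc of radius `T` meets the complement of the image of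
`h`, then the derivative of `h` at the centre is at most `96 T / R`. -/
theorem norm_deriv_mul_le_of_forall_exists_notMem_image {c : ℂ} {R T : ℝ} (hR : 0 < R)
    {h : ℂ → ℂ} (hh : DifferentiableOn ℂ h (ball c R))
    (hT : ∀ w, ∃ v, ‖v - w‖ ≤ T ∧ v ∉ h '' ball c R) : ‖deriv h c‖ * R ≤ 96 * T := by
  by_contra! hlt
  have hT0 : 0 ≤ T := by
    obtain ⟨v, hv, -⟩ := hT 0
    exact (norm_nonneg _).trans hv
  have hcb : closedBall c (R / 2) ⊆ ball c R := closedBall_subset_ball (by linarith)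
  have hd' : DifferentiableOn ℂ (deriv h) (ball c R) := hh.deriv isOpen_ball
  -- Landau's choice of `p`: nearby, `h'` is at most twice as large as at `p`, so that `h` is close
  -- to its linear part there, while `‖h' p‖ * s` is not smaller than `‖h' c‖ * (R / 2)`.
  obtain ⟨p, hp, hmax⟩ := (isCompact_closedBall c (R / 2)).exists_isMaxOn
    ⟨c, mem_closedBall_self (by positivity)⟩
    (f := fun z => ‖deriv h z‖ * (R / 2 - ‖z - c‖))
    ((hd'.continuousOn.mono hcb).norm.mul (by fun_prop))
  set A := ‖deriv h p‖ with hA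
  set s := R / 2 - ‖p - c‖ with hs
  have hAs : 48 * T < A * s := by
    have h1 := hmax (mem_closedBall_self (x := c) (by positivity))
    simp only [mem_ofPred_eq, sub_self, norm_zero, sub_zero] at h1
    rw [← hA, ← hs] at h1
    linarith
  have hs0 : 0 ≤ s := by
    rw [mem_closedBall, dist_eq_norm] at hp
    linarith
  have hs1 : 0 < s := hs0.lt_of_ne (fun h => by rw [← h] at hAs; linarith)
  have hA1 : 0 < A := (norm_nonneg _).lt_of_ne (fun h => by
    have : A = 0 := h.symm
    rw [this] at hAs; linarith)
  have hsub : ball p (s / 2) ⊆ ball c R := fun z hz => by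
    rw [mem_ball, dist_eq_norm] at hz ⊢
    have := norm_sub_le_norm_sub_add_norm_sub z p c
    linarith
  have hbound : ∀ z ∈ ball p (s / 2), ‖deriv h z‖ ≤ 2 * A := by
    intro z hz
    rw [mem_ball, dist_eq_norm] at hz
    have h1 := norm_sub_le_norm_sub_add_norm_sub z p c
    have h2 : z ∈ closedBall c (R / 2) := by
      rw [mem_closedBall, dist_eq_norm]; linarith
    have h3 := hmax h2
    simp only [mem_ofPred_eq] at h3
    have h4 : s / 2 ≤ R / 2 - ‖z - c‖ := by linarith
    have h5 : ‖deriv h z‖ * (s / 2) ≤ A * s :=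
      (mul_le_mul_of_nonneg_left h4 (norm_nonneg _)).trans h3
    nlinarith
  have hschwarz : ∀ z ∈ closedBall p (s / 12), ‖deriv h z - deriv h p‖ ≤ A / 2 := by
    intro z hz
    have hz' : z ∈ ball p (s / 2) := closedBall_subset_ball (by linarith) hz
    have h1 := dist_le_div_mul_dist_of_mapsTo_ball (hd'.mono hsub) (R₂ := 3 * A)
      (fun w hw => by
        rw [mem_closedBall, dist_eq_norm]
        linarith [norm_sub_le (deriv h w) (deriv h p), hbound w hw]) hz'
    rw [dist_eq_norm] at h1
    rw [mem_closedBall] at hz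
    calc _ ≤ _ := h1
      _ ≤ 3 * A / (s / 2) * (s / 12) := by gcongr
      _ = A / 2 := by field_simp; norm_num
  have hlower : ∀ z ∈ closedBall p (s / 12), A / 2 * ‖z - p‖ ≤ ‖h z - h p‖ := by
    intro z hz
    have hder : ∀ w ∈ closedBall p (s / 12),
        HasDerivAt (fun w => h w - deriv h p * w) (deriv h w - deriv h p) w := by
      intro w hw
      have hw' : w ∈ ball c R := hsub (closedBall_subset_ball (by linarith) hw)
      simpa using ((hh w hw').differentiableAt (isOpen_ball.mem_nhds hw')).hasDerivAt.fun_sub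
        ((hasDerivAt_id' w).const_mul (deriv h p))
    have h1 := (convex_closedBall p (s / 12)).norm_image_sub_le_of_norm_hasDerivWithin_le
      (fun w hw => (hder w hw).hasDerivWithinAt) hschwarz
      (mem_closedBall_self (by positivity)) hz
    have h2 : ‖deriv h p * (z - p)‖ = A * ‖z - p‖ := norm_mul _ _
    have h3 : deriv h p * (z - p)
        = (h z - h p) - ((h z - deriv h p * z) - (h p - deriv h p * p)) := by ring
    have h4 := norm_sub_le (h z - h p) ((h z - deriv h p * z) - (h p - deriv h p * p))
    rw [← h3, h2] at h4
    linarith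
  have hcl : closedBall p (s / 12) ⊆ ball c R := fun z hz =>
    hsub (closedBall_subset_ball (by linarith) hz)
  have himg := DiffContOnCl.ball_subset_image_closedBall (f := h) (z₀ := p) (r := s / 12)
    (ε := A * s / 24) ((hh.mono hcl).diffContOnCl_ball subset_rfl)
    (by positivity) (fun z hz => by
      have h1 := hlower z (sphere_subset_closedBall hz)
      rw [mem_sphere, dist_eq_norm] at hz
      rw [hz] at h1
      linarith) (by
      have h1 : ∀ᶠ z in 𝓝[≠] p, h z ≠ h p := by
        filter_upwards [self_mem_nhdsWithin,
          mem_nhdsWithin_of_mem_nhds (closedBall_mem_nhds p (by positivity : 0 < s / 12))]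
          with z hz hz' heq
        have h2 := hlower z hz'
        rw [heq, sub_self, norm_zero] at h2
        have h3 : 0 < ‖z - p‖ := norm_pos_iff.2 (sub_ne_zero.2 hz)
        nlinarith
      exact h1.frequently.filter_mono nhdsWithin_le_nhds)
  obtain ⟨v, hv, hvn⟩ := hT (h p)
  refine hvn (image_mono hcl (himg ?_))
  rw [mem_ball, dist_eq_norm]
  linarith

theorem norm_cos_le_exp_norm (v : ℂ) : ‖cos v‖ ≤ Real.exp ‖v‖ := by
  rw [cos, norm_div]
  have h1 : ‖exp (v * I)‖ ≤ Real.exp ‖v‖ := (norm_exp_le_exp_norm _).trans (by simp)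
  have h2 : ‖exp (-v * I)‖ ≤ Real.exp ‖v‖ := (norm_exp_le_exp_norm _).trans (by simp)
  have h3 := norm_add_le (exp (v * I)) (exp (-v * I))
  simp only [RCLike.norm_ofNat]
  linarith

/-- **Schottky's theorem**, at half the radius and with an unspecified constant. -/
theorem schottky (M : ℝ) : ∃ C : ℝ, ∀ (c : ℂ) (R : ℝ) (f : ℂ → ℂ), 0 < R →
    DifferentiableOn ℂ f (ball c R) → (∀ z ∈ ball c R, f z ≠ 0) → (∀ z ∈ ball c R, f z ≠ 1) →
    ‖f c‖ ≤ M → ∀ z ∈ closedBall c (R / 2), ‖f z‖ ≤ C := by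
  refine ⟨1 + Real.exp (Real.pi * Real.exp (585 + 2 * M)), fun c R f hR hf h0 h1 hM z hz => ?_⟩
  have hp := Real.pi_pos
  have hp3 := Real.pi_gt_three
  have hpC : (Real.pi : ℂ) ≠ 0 := ofReal_ne_zero.2 hp.ne'
  have hpn : ‖(Real.pi : ℂ)‖ = Real.pi := by rw [norm_real, Real.norm_of_nonneg hp.le]
  -- `2 f - 1 = cos F`, where `F / π` omits the integers because `f` omits `0` and `1`.
  obtain ⟨F, hF, hFc, hFb⟩ := exists_cos_eq_on_ball hR (f := fun z => 2 * f z - 1)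
    ((hf.const_mul 2).sub_const 1) (fun z hz h => h1 z hz (by linear_combination h / 2))
    (fun z hz h => h0 z hz (by linear_combination h / 2))
  have hcosint : ∀ n : ℤ, cos (n * Real.pi) = (-1) ^ n := fun n => by
    have h := congrArg ((↑) : ℝ → ℂ) (Real.cos_int_mul_pi n)
    push_cast at h
    exact h
  have hFint : ∀ z ∈ ball c R, ∀ n : ℤ, F z / Real.pi ≠ n := by
    intro z hz n h
    have h2 : F z = n * Real.pi := (div_eq_iff hpC).1 h
    have h3 := hFc z hz
    rw [h2, hcosint] at h3
    rcases Int.even_or_odd n with hn | hn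
    · rw [hn.neg_one_zpow] at h3
      exact h1 z hz (by linear_combination -h3 / 2)
    · rw [hn.neg_one_zpow] at h3
      exact h0 z hz (by linear_combination -h3 / 2)
  -- `F / π = cos G`, where `G` omits all points with an integral cosine.
  obtain ⟨G, hG, hGc, hGb⟩ := exists_cos_eq_on_ball hR (f := fun z => F z / Real.pi)
    (hF.div_const _) (fun z hz => by simpa only [Int.cast_one] using hFint z hz 1)
    (fun z hz => by simpa only [Int.cast_neg, Int.cast_one] using hFint z hz (-1))
  have hder : ∀ w ∈ closedBall c (R / 2), ‖deriv G w‖ ≤ 1152 / R := by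
    intro w hw
    have hsub : ball w (R / 2) ⊆ ball c R := fun u hu => by
      rw [mem_ball] at hu ⊢
      rw [mem_closedBall] at hw
      linarith [dist_triangle u w c]
    have h2 := norm_deriv_mul_le_of_forall_exists_notMem_image (T := 6) (half_pos hR)
      (hG.mono hsub) (fun u => by
        obtain ⟨v, hv, n, hn⟩ := exists_cos_eq_int_near u
        refine ⟨v, hv, ?_⟩
        rintro ⟨x, hx, rfl⟩
        exact hFint x (hsub hx) n ((hGc x (hsub hx)).symm.trans hn))
    rw [le_div_iff₀ hR]
    linarith
  have hdiff := (convex_closedBall c (R / 2)).norm_image_sub_le_of_norm_deriv_le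
    (fun w hw => (hG w (closedBall_subset_ball (by linarith) hw)).differentiableAt
      (isOpen_ball.mem_nhds (closedBall_subset_ball (by linarith) hw))) hder
    (mem_closedBall_self (by positivity)) hz
  have hdiff' : ‖G z - G c‖ ≤ 576 := by
    refine hdiff.trans ?_
    rw [mem_closedBall, dist_eq_norm] at hz
    calc _ ≤ 1152 / R * (R / 2) := by gcongr
      _ = 576 := by field_simp; norm_num
  have hFM : ‖F c‖ ≤ 5 + 2 * M := by
    have h2 : ‖2 * f c - 1‖ ≤ 2 * M + 1 := by
      refine (norm_sub_le _ _).trans ?_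
      rw [norm_mul]
      simp only [RCLike.norm_ofNat, norm_one]
      linarith
    linarith
  have hGz : ‖G z‖ ≤ 585 + 2 * M := by
    have h2 : ‖F c / Real.pi‖ ≤ ‖F c‖ := by
      rw [norm_div, hpn]
      exact div_le_self (norm_nonneg _) (by linarith)
    have h3 := norm_sub_le_norm_sub_add_norm_sub (G z) (G c) 0
    simp only [sub_zero] at h3
    linarith
  have hz' : z ∈ ball c R := closedBall_subset_ball (by linarith) hz
  have hfz : 2 * f z = 1 + cos (Real.pi * cos (G z)) := by
    rw [hGc z hz', mul_div_cancel₀ _ hpC, hFc z hz']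
    ring
  have h2 : ‖cos (Real.pi * cos (G z))‖ ≤ Real.exp (Real.pi * Real.exp (585 + 2 * M)) := by
    refine (norm_cos_le_exp_norm _).trans (Real.exp_le_exp.2 ?_)
    rw [norm_mul, hpn]
    gcongr
    exact (norm_cos_le_exp_norm _).trans (Real.exp_le_exp.2 hGz)
  have h3 : 2 * ‖f z‖ ≤ 1 + ‖cos (Real.pi * cos (G z))‖ := by
    have h4 := norm_add_le 1 (cos (Real.pi * cos (G z)))
    rw [← hfz, norm_mul] at h4
    simpa using h4
  linarith [norm_nonneg (f z)]

/-! ### The great Picard theorem for functions omitting two values -/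

theorem exists_eq_exp_mul_of_norm_eq {z z' : ℂ} (hz : z ≠ 0) (h : ‖z'‖ = ‖z‖) :
    ∃ u : ℂ, ‖u‖ < 4 ∧ z' = exp u * z := by
  refine ⟨(z' / z).arg * I, ?_, ?_⟩
  · rw [norm_mul, norm_I, mul_one, norm_real, Real.norm_eq_abs]
    exact (abs_arg_le_pi _).trans_lt Real.pi_lt_four
  · have h1 := norm_mul_exp_arg_mul_I (z' / z)
    rw [norm_div, h, div_self (norm_ne_zero_iff.2 hz), ofReal_one, one_mul] at h1
    rw [h1, div_mul_cancel₀ _ hz]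

/-- The maximum principle in a closed annulus (which may be degenerate). -/
theorem norm_le_of_norm_le_on_circles {f : ℂ → ℂ} {r s C : ℝ}
    (hf : ∀ z, s ≤ ‖z‖ → ‖z‖ ≤ r → DifferentiableAt ℂ f z)
    (hr : ∀ z, ‖z‖ = r → ‖f z‖ ≤ C) (hsC : ∀ z, ‖z‖ = s → ‖f z‖ ≤ C)
    {z : ℂ} (hz : s ≤ ‖z‖) (hz' : ‖z‖ ≤ r) : ‖f z‖ ≤ C := by
  rcases hz.eq_or_lt with h1 | h1
  · exact hsC z h1.symm
  rcases hz'.eq_or_lt with h2 | h2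
  · exact hr z h2
  set U : Set ℂ := {z | s < ‖z‖ ∧ ‖z‖ < r} with hU
  have hUo : IsOpen U := (isOpen_lt continuous_const continuous_norm).inter
    (isOpen_lt continuous_norm continuous_const)
  have hcl : closure U ⊆ {z | s ≤ ‖z‖ ∧ ‖z‖ ≤ r} :=
    closure_minimal (fun z hz => ⟨hz.1.le, hz.2.le⟩)
      ((isClosed_le continuous_const continuous_norm).inter
        (isClosed_le continuous_norm continuous_const))
  have hd : DiffContOnCl ℂ f U := DifferentiableOn.diffContOnCl fun w hw =>
    (hf w (hcl hw).1 (hcl hw).2).differentiableWithinAt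
  refine norm_le_of_forall_mem_frontier_norm_le
    ((isBounded_ball (x := (0 : ℂ)) (r := r)).subset fun w hw => by simpa using hw.2) hd
    (fun w hw => ?_) (subset_closure (show z ∈ U from ⟨h1, h2⟩))
  rw [frontier, hUo.interior_eq] at hw
  obtain ⟨hw1, hw2⟩ := hcl hw.1
  rcases hw1.eq_or_lt with h3 | h3
  · exact hsC w h3.symm
  rcases hw2.eq_or_lt with h4 | h4
  · exact hr w h4
  exact absurd ⟨h3, h4⟩ hw.2

/-- The **great Picard theorem** for a holomorphic function omitting `0` and `1`. -/
theorem great_picard_of_omits_zero_one {f : ℂ → ℂ}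
    (hf : DifferentiableOn ℂ f (ball 0 1 \ {0})) (h0 : ∀ z ∈ ball (0 : ℂ) 1 \ {0}, f z ≠ 0)
    (h1 : ∀ z ∈ ball (0 : ℂ) 1 \ {0}, f z ≠ 1) :
    (∃ a, Tendsto f (𝓝[≠] 0) (𝓝 a)) ∨ Tendsto f (𝓝[≠] 0) (Bornology.cobounded ℂ) := by
  refine or_iff_not_imp_right.2 fun hnot => ?_
  rw [← tendsto_norm_atTop_iff_cobounded, Filter.tendsto_atTop] at hnot
  push Not at hnot
  obtain ⟨M, hM⟩ := hnot
  obtain ⟨C, hC⟩ := schottky M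
  have hopen : IsOpen (ball (0 : ℂ) 1 \ {0}) := isOpen_ball.sdiff isClosed_singleton
  have hexp : ∀ w : ℂ, w.re < 0 → exp w ∈ ball (0 : ℂ) 1 \ {0} := fun w hw =>
    ⟨by simpa [norm_exp] using hw, exp_ne_zero w⟩
  -- The disc of radius `8` around `log z` lies in the left half plane, and the concentric disc of
  -- radius `4 > π` contains a logarithm of each point of the circle through `z`.
  have hcircle : ∀ z : ℂ, z ≠ 0 → ‖z‖ < Real.exp (-8) → ‖f z‖ ≤ M → ∀ z', ‖z'‖ = ‖z‖ →
      ‖f z'‖ ≤ C := by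
    intro z hz hz8 hzM z' hz'
    obtain ⟨u, hu, rfl⟩ := exists_eq_exp_mul_of_norm_eq hz hz'
    have hre : (log z).re < -8 := by
      rw [log_re]
      exact (Real.log_lt_iff_lt_exp (norm_pos_iff.2 hz)).2 hz8
    have hmem : ∀ w ∈ ball (log z) 8, exp w ∈ ball (0 : ℂ) 1 \ {0} := fun w hw => hexp w (by
      rw [mem_ball, dist_eq_norm] at hw
      have := (abs_le.1 (abs_re_le_norm (w - log z))).2
      rw [sub_re] at this
      linarith)
    have h2 := hC (log z) 8 (fun w => f (exp w)) (by norm_num)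
      (hf.comp differentiable_exp.differentiableOn hmem) (fun w hw => h0 _ (hmem w hw))
      (fun w hw => h1 _ (hmem w hw)) (by simpa only [exp_log hz] using hzM) (u + log z) (by
        rw [mem_closedBall, dist_eq_norm, add_sub_cancel_right]
        linarith)
    simpa only [exp_add, exp_log hz] using h2
  have hsmall : ∀ r > 0, ∃ z : ℂ, z ≠ 0 ∧ ‖z‖ < r ∧ ‖f z‖ ≤ M := by
    intro r hr
    obtain ⟨z, hz1, hz2, hz3⟩ := (hM.and_eventually
      ((eventually_mem_nhdsWithin (a := (0 : ℂ)) (s := {0}ᶜ)).and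
        (mem_nhdsWithin_of_mem_nhds (ball_mem_nhds 0 hr)))).exists
    exact ⟨z, hz2, by simpa using hz3, hz1.le⟩
  obtain ⟨z₁, hz₁, hz₁r, hz₁M⟩ := hsmall (Real.exp (-8)) (Real.exp_pos _)
  have hlt1 : Real.exp (-8) < 1 := by simp
  have hbound : ∀ z : ℂ, z ≠ 0 → ‖z‖ < ‖z₁‖ → ‖f z‖ ≤ C := by
    intro z hz hzr
    obtain ⟨z₂, hz₂, hz₂r, hz₂M⟩ := hsmall ‖z‖ (norm_pos_iff.2 hz)
    refine norm_le_of_norm_le_on_circles (fun w hw hw' => ?_)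
      (fun w hw => hcircle z₁ hz₁ hz₁r hz₁M w hw)
      (fun w hw => hcircle z₂ hz₂ (by linarith) hz₂M w hw) hz₂r.le hzr.le
    have hw0 : 0 < ‖w‖ := (norm_pos_iff.2 hz₂).trans_le hw
    have hmem : w ∈ ball (0 : ℂ) 1 \ {0} := ⟨by simp; linarith, norm_pos_iff.1 hw0⟩
    exact (hf w hmem).differentiableAt (hopen.mem_nhds hmem)
  refine ⟨limUnder (𝓝[≠] 0) f,
    tendsto_limUnder_of_differentiable_on_punctured_nhds_of_bounded_under ?_ ?_⟩
  · filter_upwards [self_mem_nhdsWithin,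
      mem_nhdsWithin_of_mem_nhds (ball_mem_nhds (0 : ℂ) one_pos)] with z hz hz'
    exact (hf z ⟨hz', hz⟩).differentiableAt (hopen.mem_nhds ⟨hz', hz⟩)
  · refine ⟨C + ‖f 0‖, ?_⟩
    rw [eventually_map]
    filter_upwards [self_mem_nhdsWithin,
      mem_nhdsWithin_of_mem_nhds (ball_mem_nhds (0 : ℂ) (norm_pos_iff.2 hz₁))] with z hz hz'
    exact (norm_sub_le _ _).trans (by gcongr; exact hbound z hz (by simpa using hz'))

theorem great_picard_of_omits {f : ℂ → ℂ} {a b : ℂ} (hab : a ≠ b)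
    (hf : DifferentiableOn ℂ f (ball 0 1 \ {0})) (ha : ∀ z ∈ ball (0 : ℂ) 1 \ {0}, f z ≠ a)
    (hb : ∀ z ∈ ball (0 : ℂ) 1 \ {0}, f z ≠ b) :
    (∃ c, Tendsto f (𝓝[≠] 0) (𝓝 c)) ∨ Tendsto f (𝓝[≠] 0) (Bornology.cobounded ℂ) := by
  have hba : b - a ≠ 0 := sub_ne_zero.2 hab.symm
  have heq : ∀ z, f z = (b - a) * ((f z - a) / (b - a)) + a := fun z => by field_simp; ring
  rcases great_picard_of_omits_zero_one (f := fun z => (f z - a) / (b - a))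
    ((hf.sub_const a).div_const _) (fun z hz => div_ne_zero (sub_ne_zero.2 (ha z hz)) hba)
    (fun z hz h => hb z hz (by
      rw [div_eq_one_iff_eq hba] at h
      linear_combination h)) with ⟨c, hc⟩ | hc
  · refine .inl ⟨(b - a) * c + a, ?_⟩
    exact ((hc.const_mul _).add_const _).congr fun z => (heq z).symm
  · refine .inr ?_
    exact ((tendsto_add_const_cobounded a).comp ((tendsto_mul_left_cobounded hba).comp hc)).congr
      fun z => (heq z).symm

end OmittedValues

open Metric

/-! ### The chordal metric -/

/-- Stereographic projection onto the Euclidean sphere of diameter one in `ℂ × ℝ` through the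
origin, which is the image of `∞`. Distances on that sphere are the values of `chi`. -/
noncomputable def stereo (p : Sphere) : WithLp 2 (ℂ × ℝ) :=
  WithLp.toLp 2 (p.elim (0, 0) fun z => (((1 + ‖z‖ ^ 2)⁻¹ : ℝ) • z, (1 + ‖z‖ ^ 2)⁻¹))

theorem stereo_coe_fst (z : ℂ) : (stereo z).fst = ((1 + ‖z‖ ^ 2)⁻¹ : ℝ) • z := rfl

theorem stereo_coe_snd (z : ℂ) : (stereo z).snd = (1 + ‖z‖ ^ 2)⁻¹ := rfl

theorem stereo_infty_fst : (stereo OnePoint.infty).fst = 0 := rfl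

theorem stereo_infty_snd : (stereo OnePoint.infty).snd = 0 := rfl

theorem chi_coe_coe (z w : ℂ) :
    chi z w = ‖z - w‖ / (√(1 + ‖z‖ ^ 2) * √(1 + ‖w‖ ^ 2)) := rfl

theorem chi_coe_infty (z : ℂ) : chi z OnePoint.infty = 1 / √(1 + ‖z‖ ^ 2) := rfl

theorem chi_eq_dist (p q : Sphere) : chi p q = dist (stereo p) (stereo q) := by
  have pos : ∀ z : ℂ, 0 < 1 + ‖z‖ ^ 2 := fun z => by positivity
  have key : ∀ z : ℂ, 1 / √(1 + ‖z‖ ^ 2) = dist (stereo z) (stereo OnePoint.infty) := by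
    intro z
    rw [dist_eq_norm, WithLp.prod_norm_eq_of_L2, one_div, ← Real.sqrt_inv]
    congr 1
    simp only [WithLp.sub_fst, WithLp.sub_snd, stereo_coe_fst, stereo_coe_snd,
      stereo_infty_fst, stereo_infty_snd, sub_zero, norm_smul, norm_inv,
      Real.norm_of_nonneg (pos z).le]
    have := (pos z).ne'
    field_simp
    ring
  induction p using OnePoint.rec with
  | infty =>
    induction q using OnePoint.rec with
    | infty => simp [chi]
    | coe w => rw [dist_comm]; exact key w
  | coe z =>
    induction q using OnePoint.rec with
    | infty => exact key z
    | coe w =>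
      rw [chi_coe_coe, dist_eq_norm, WithLp.prod_norm_eq_of_L2, ← Real.sqrt_mul (pos z).le,
        eq_comm, Real.sqrt_eq_iff_eq_sq (by positivity) (by positivity), div_pow,
        Real.sq_sqrt (mul_pos (pos z) (pos w)).le]
      simp only [WithLp.sub_fst, WithLp.sub_snd, stereo_coe_fst, stereo_coe_snd]
      have hz := pos z
      have hw := pos w
      simp only [Complex.sq_norm, Complex.normSq_apply, Real.norm_eq_abs, sq_abs, Complex.sub_re,
        Complex.sub_im, Complex.smul_re, Complex.smul_im, smul_eq_mul] at hz hw ⊢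
      field_simp
      ring

theorem chi_nonneg (p q : Sphere) : 0 ≤ chi p q := by rw [chi_eq_dist]; exact dist_nonneg

theorem chi_comm (p q : Sphere) : chi p q = chi q p := by simp only [chi_eq_dist, dist_comm]

theorem chi_triangle (p q r : Sphere) : chi p r ≤ chi p q + chi q r := by
  simp only [chi_eq_dist]; exact dist_triangle _ _ _

theorem continuous_stereo : Continuous stereo := by
  rw [continuous_iff_continuousAt]
  intro p
  induction p using OnePoint.rec with
  | infty =>
    rw [OnePoint.continuousAt_infty', coclosedCompact_eq_cocompact,
      ← Metric.cobounded_eq_cocompact, tendsto_iff_dist_tendsto_zero]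
    simp only [Function.comp_apply, ← chi_eq_dist, chi_coe_infty, one_div]
    refine tendsto_inv_atTop_zero.comp (Real.tendsto_sqrt_atTop.comp ?_)
    exact tendsto_atTop_add_const_left _ _
      ((tendsto_pow_atTop two_ne_zero).comp tendsto_norm_cobounded_atTop)
  | coe z =>
    rw [OnePoint.continuousAt_coe]
    have h : ∀ z : ℂ, 1 + ‖z‖ ^ 2 ≠ 0 := fun z => by positivity
    have h2 : Continuous fun z : ℂ => (1 + ‖z‖ ^ 2)⁻¹ := Continuous.inv₀ (by fun_prop) h
    exact ((WithLp.prod_continuous_toLp 2 ℂ ℝ).comp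
      ((h2.smul continuous_id).prodMk h2)).continuousAt

/-- On bounded subsets of the plane the Euclidean distance is uniformly controlled by `chi`. -/
theorem exists_chi_lt_imp_coe {A η : ℝ} (hη : 0 < η) : ∃ ε > 0, ∀ p : ℂ, ‖p‖ ≤ A →
    ∀ q : Sphere, chi p q < ε → ∃ w : ℂ, q = w ∧ ‖p - w‖ < η := by
  set s := 1 / √(1 + A ^ 2) with hs
  have hs0 : 0 < s := by positivity
  refine ⟨min (s / 2) (η * (s * (s / 2))), by positivity, fun p hp q hq => ?_⟩
  have hps : s ≤ chi p OnePoint.infty := by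
    rw [chi_coe_infty, hs]
    gcongr
  induction q using OnePoint.rec with
  | infty => linarith [hq.trans_le (min_le_left _ _)]
  | coe w =>
    refine ⟨w, rfl, ?_⟩
    have h1 := chi_triangle p w OnePoint.infty
    have h2 : s / 2 ≤ chi w OnePoint.infty := by linarith [hq.trans_le (min_le_left _ _)]
    have h3 : chi p w = ‖p - w‖ * (chi p OnePoint.infty * chi w OnePoint.infty) := by
      rw [chi_coe_coe, chi_coe_infty, chi_coe_infty]
      field_simp
    have h4 : ‖p - w‖ * (s * (s / 2)) ≤ chi p w := by
      rw [h3]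
      have := chi_nonneg p OnePoint.infty
      gcongr
    exact lt_of_mul_lt_mul_right (h4.trans_lt (hq.trans_le (min_le_right _ _))) (by positivity)

/-! ### Sphere-valued maps in the charts -/

theorem mdifferentiableAt_finitePart {p : Sphere} (hp : p ≠ OnePoint.infty) :
    MDifferentiableAt 𝓘(ℂ) 𝓘(ℂ) finitePart p :=
  mdifferentiableAt_atlas (e := finiteChart) (Or.inl rfl) hp

theorem mdifferentiableAt_invFinitePart {p : Sphere} (hp : p ≠ ((0 : ℂ) : Sphere)) :
    MDifferentiableAt 𝓘(ℂ) 𝓘(ℂ) invFinitePart p :=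
  mdifferentiableAt_atlas (e := infinityChart) (Or.inr rfl) hp

theorem mdifferentiable_coe : MDifferentiable 𝓘(ℂ) 𝓘(ℂ) ((↑) : ℂ → Sphere) := fun z =>
  mdifferentiableAt_atlas_symm (e := finiteChart) (Or.inl rfl) (mem_univ z)

theorem mdifferentiable_invToSphere : MDifferentiable 𝓘(ℂ) 𝓘(ℂ) invToSphere := fun z =>
  mdifferentiableAt_atlas_symm (e := infinityChart) (Or.inr rfl) (mem_univ z)

theorem coe_finitePart {p : Sphere} (hp : p ≠ OnePoint.infty) : (finitePart p : Sphere) = p :=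
  finiteChart.left_inv hp

theorem differentiableAt_finitePart_comp {f : ℂ → Sphere} {z : ℂ}
    (hf : MDifferentiableAt 𝓘(ℂ) 𝓘(ℂ) f z) (hz : f z ≠ OnePoint.infty) :
    DifferentiableAt ℂ (fun z => finitePart (f z)) z :=
  mdifferentiableAt_iff_differentiableAt.1 ((mdifferentiableAt_finitePart hz).comp z hf)

theorem differentiableAt_invFinitePart_comp {f : ℂ → Sphere} {z : ℂ}
    (hf : MDifferentiableAt 𝓘(ℂ) 𝓘(ℂ) f z) (hz : f z ≠ ((0 : ℂ) : Sphere)) :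
    DifferentiableAt ℂ (fun z => invFinitePart (f z)) z :=
  mdifferentiableAt_iff_differentiableAt.1 ((mdifferentiableAt_invFinitePart hz).comp z hf)

/-- Removable singularities for maps into the sphere. -/
theorem mdifferentiableAt_update_of_tendsto {f : ℂ → Sphere} {p : Sphere} {z₀ : ℂ}
    (hf : ∀ᶠ z in 𝓝[≠] z₀, MDifferentiableAt 𝓘(ℂ) 𝓘(ℂ) f z) (hp : Tendsto f (𝓝[≠] z₀) (𝓝 p)) :
    MDifferentiableAt 𝓘(ℂ) 𝓘(ℂ) (Function.update f z₀ p) z₀ := by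
  set F := Function.update f z₀ p with hF
  have hc : ContinuousAt F z₀ := continuousAt_update_same.2 hp
  have hF0 : F z₀ = p := Function.update_self ..
  have hd : ∀ᶠ z in 𝓝[≠] z₀, MDifferentiableAt 𝓘(ℂ) 𝓘(ℂ) F z := by
    filter_upwards [hf, self_mem_nhdsWithin] with z hz hz0
    refine hz.congr_of_eventuallyEq ?_
    filter_upwards [isOpen_ne.mem_nhds hz0] with w hw
    exact Function.update_of_ne hw _ _
  by_cases hpi : p = OnePoint.infty
  · have hne : ∀ᶠ z in 𝓝 z₀, F z ≠ ((0 : ℂ) : Sphere) :=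
      hc.eventually_ne (by rw [hF0, hpi]; exact OnePoint.infty_ne_coe 0)
    have hcomp : ContinuousAt (fun z => invFinitePart (F z)) z₀ :=
      (mdifferentiableAt_invFinitePart hne.self_of_nhds).continuousAt.comp hc
    have ha := Complex.analyticAt_of_differentiable_on_punctured_nhds_of_continuousAt (by
      filter_upwards [hd, hne.filter_mono nhdsWithin_le_nhds] with z h1 h2
      exact differentiableAt_invFinitePart_comp h1 h2) hcomp
    refine ((mdifferentiable_invToSphere _).comp z₀
      ha.differentiableAt.mdifferentiableAt).congr_of_eventuallyEq ?_
    filter_upwards [hne] with z hz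
    exact (infinityChart.left_inv hz).symm
  · have hne : ∀ᶠ z in 𝓝 z₀, F z ≠ OnePoint.infty := hc.eventually_ne (by rwa [hF0])
    have hcomp : ContinuousAt (fun z => finitePart (F z)) z₀ :=
      (mdifferentiableAt_finitePart hne.self_of_nhds).continuousAt.comp hc
    have ha := Complex.analyticAt_of_differentiable_on_punctured_nhds_of_continuousAt (by
      filter_upwards [hd, hne.filter_mono nhdsWithin_le_nhds] with z h1 h2
      exact differentiableAt_finitePart_comp h1 h2) hcomp
    refine ((mdifferentiable_coe _).comp z₀
      ha.differentiableAt.mdifferentiableAt).congr_of_eventuallyEq ?_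
    filter_upwards [hne] with z hz
    exact (finiteChart.left_inv hz).symm

/-! ### Limits from small oscillation on circles -/

/-- By compactness of the sphere, a map without limit has two cluster values, one of which is
finite. -/
theorem exists_mapClusterPt_coe_ne {f : ℂ → Sphere}
    (h : ¬ ∃ p, Tendsto f (𝓝[≠] 0) (𝓝 p)) :
    ∃ (a : ℂ) (b : Sphere), b ≠ a ∧ MapClusterPt (a : Sphere) (𝓝[≠] 0) f ∧
      MapClusterPt b (𝓝[≠] 0) f := by
  obtain ⟨p, hp⟩ := exists_clusterPt_of_compactSpace (map f (𝓝[≠] 0))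
  obtain ⟨q, hq, hqp⟩ : ∃ q, ClusterPt q (map f (𝓝[≠] 0)) ∧ q ≠ p := by
    by_contra! hall
    exact h ⟨p, le_nhds_of_unique_clusterPt hall⟩
  induction p using OnePoint.rec with
  | infty =>
    induction q using OnePoint.rec with
    | infty => exact absurd rfl hqp
    | coe a => exact ⟨a, _, hqp.symm, hq, hp⟩
  | coe a => exact ⟨a, q, hqp, hp, hq⟩

/-- A holomorphic map on the punctured disc whose oscillation on the circle `|z| = r` tends to `0`
with `r` has a limit at the puncture. -/
theorem exists_tendsto_of_circle_oscillation {f : ℂ → Sphere}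
    (hf : ∀ z ∈ ball (0 : ℂ) 1 \ {0}, MDifferentiableAt 𝓘(ℂ) 𝓘(ℂ) f z)
    (hosc : ∀ ε > 0, ∃ ρ > 0, ∀ z z' : ℂ, z ≠ 0 → ‖z‖ < ρ → ‖z'‖ = ‖z‖ → chi (f z) (f z') < ε) :
    ∃ p, Tendsto f (𝓝[≠] 0) (𝓝 p) := by
  by_contra hnot
  obtain ⟨a, b, hba, ha, hb⟩ := exists_mapClusterPt_coe_ne hnot
  obtain ⟨V, U, hV, hU, hbV, haU, hVU⟩ := t2_separation hba
  obtain ⟨δ, hδ, hδU⟩ := Metric.isOpen_iff.1 (hU.preimage OnePoint.continuous_coe) a haU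
  obtain ⟨ε, hε, hnear⟩ := exists_chi_lt_imp_coe (A := ‖a‖ + δ) (η := δ / 64) (by positivity)
  obtain ⟨ρ, hρ, hρosc⟩ := hosc ε hε
  have hcirc : ∀ z z' : ℂ, z ≠ 0 → ‖z‖ < ρ → ‖z'‖ = ‖z‖ → ∀ p : ℂ, f z = p → ‖p - a‖ ≤ δ →
      ∃ w : ℂ, f z' = w ∧ ‖p - w‖ < δ / 64 := by
    intro z z' hz hzρ hzz p hp hpa
    refine hnear p ?_ _ (hp ▸ hρosc z z' hz hzρ hzz)
    linarith [norm_sub_norm_le p a]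
  have hsmall : ∀ P : Sphere → Prop, (∃ᶠ z in 𝓝[≠] (0 : ℂ), P (f z)) → ∀ r > 0,
      ∃ z : ℂ, z ≠ 0 ∧ ‖z‖ < r ∧ P (f z) := by
    intro P hP r hr
    obtain ⟨z, hz1, hz2, hz3⟩ := (hP.and_eventually
      ((eventually_mem_nhdsWithin (a := (0 : ℂ)) (s := {0}ᶜ)).and
        (mem_nhdsWithin_of_mem_nhds (ball_mem_nhds 0 hr)))).exists
    exact ⟨z, hz2, by simpa using hz3, hz1⟩
  have hballo : IsOpen (OnePoint.some '' ball a (δ / 64)) :=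
    OnePoint.isOpenEmbedding_coe.isOpenMap _ isOpen_ball
  -- The outer circle `|z| = r`, on which `f` is close to `a`.
  obtain ⟨z₁, hz₁, hz₁r, p₁, hp₁, hfp₁⟩ := hsmall (fun p => p ∈ OnePoint.some '' ball a (δ / 64))
    (ha.frequently (hballo.mem_nhds ⟨a, mem_ball_self (by positivity), rfl⟩)) (min ρ 1)
    (by positivity)
  set r := ‖z₁‖ with hr
  have hr0 : 0 < r := norm_pos_iff.2 hz₁
  have hrρ : r < ρ := hz₁r.trans_le (min_le_left _ _)
  have hr1 : r < 1 := hz₁r.trans_le (min_le_right _ _)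
  -- A point `z₂` inside that circle at which `f` is far from `a`.
  obtain ⟨z₂, hz₂, hz₂r, hfz₂⟩ := hsmall (fun p => p ∈ V)
    (hb.frequently (hV.mem_nhds hbV)) r hr0
  set s₀ := ‖z₂‖ with hs₀
  have hs₀0 : 0 < s₀ := norm_pos_iff.2 hz₂
  have hfar : ∀ w : ℂ, f z₂ = w → δ ≤ ‖w - a‖ := by
    intro w hw
    by_contra! hlt
    exact disjoint_left.1 hVU hfz₂ (hw ▸ hδU (by rwa [mem_ball, dist_eq_norm]))
  have nrm : ∀ t : ℝ, 0 < t → ‖(t : ℂ)‖ = t := fun t ht => by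
    rw [Complex.norm_real, Real.norm_of_nonneg ht.le]
  have ne0 : ∀ t : ℝ, 0 < t → (t : ℂ) ≠ 0 := fun t ht => Complex.ofReal_ne_zero.2 ht.ne'
  have hcont : ContinuousOn (fun t : ℝ => f t) (Icc s₀ r) := fun t ht =>
    have ht0 : 0 < t := hs₀0.trans_le ht.1
    have htm : (t : ℂ) ∈ ball (0 : ℂ) 1 \ {0} :=
      ⟨by rw [mem_ball_zero_iff, nrm t ht0]; exact ht.2.trans_lt hr1, ne0 t ht0⟩
    ((hf t htm).continuousAt.comp
      Complex.continuous_ofReal.continuousAt).continuousWithinAt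
  -- The inner circle `|z| = s`: the last radius in `[s₀, r]` at which `f` has distance at least
  -- `δ / 2` from `a`.
  set E : Set ℝ := Icc s₀ r ∩ (fun t : ℝ => f t) ⁻¹' ((↑) '' ball a (δ / 2))ᶜ with hE
  have hEc : IsCompact E := isCompact_Icc.of_isClosed_subset
    (hcont.preimage_isClosed_of_isClosed isClosed_Icc
      (OnePoint.isOpenEmbedding_coe.isOpenMap _ isOpen_ball).isClosed_compl) inter_subset_left
  have hs₀E : s₀ ∈ E := by
    refine ⟨⟨le_rfl, hz₂r.le⟩, ?_⟩
    rintro ⟨w, hw, hwf⟩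
    rw [mem_ball, dist_eq_norm] at hw
    obtain ⟨w', hw', hww'⟩ := hcirc s₀ z₂ (ne0 _ hs₀0) (by rw [nrm _ hs₀0]; linarith)
      (nrm _ hs₀0).symm w hwf.symm (by linarith)
    have h1 := hfar w' hw'
    have h2 := norm_sub_le_norm_sub_add_norm_sub w' w a
    rw [norm_sub_rev w' w] at h2
    linarith
  obtain ⟨s, ⟨⟨hs₀s, hsr⟩, hsE⟩, hsmax⟩ := hEc.exists_isGreatest ⟨s₀, hs₀E⟩
  have hs0 : 0 < s := hs₀0.trans_le hs₀s
  obtain ⟨wr, hwr, hwrp⟩ := hcirc z₁ r hz₁ hrρ (nrm r hr0) p₁ hfp₁.symm (by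
    rw [mem_ball, dist_eq_norm] at hp₁; linarith)
  have hwra : ‖wr - a‖ < δ / 32 := by
    rw [mem_ball, dist_eq_norm] at hp₁
    have h2 := norm_sub_le_norm_sub_add_norm_sub wr p₁ a
    rw [norm_sub_rev wr p₁] at h2
    linarith
  have hsr' : s < r := hsr.lt_of_ne (by
    rintro rfl
    exact hsE ⟨wr, by rw [mem_ball, dist_eq_norm]; linarith, hwr.symm⟩)
  have hIoc : Ioc s r ⊆ Icc s r ∩ (fun t : ℝ => f t) ⁻¹' ((↑) '' closedBall a (δ / 2)) := by
    intro t ht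
    refine ⟨Ioc_subset_Icc_self ht, ?_⟩
    by_contra hn
    have : t ∈ E := ⟨⟨hs₀s.trans ht.1.le, ht.2⟩, fun h => hn (image_mono ball_subset_closedBall h)⟩
    exact absurd (hsmax this) (not_le.2 ht.1)
  have hIcc := closure_minimal hIoc <|
    (hcont.mono (Icc_subset_Icc_left hs₀s)).preimage_isClosed_of_isClosed isClosed_Icc
      ((isCompact_closedBall a (δ / 2)).image OnePoint.continuous_coe).isClosed
  rw [closure_Ioc hsr'.ne] at hIcc
  set G : ℂ → ℂ := fun z => finitePart (f z) with hG
  have hGt : ∀ t ∈ Icc s r, f (t : ℂ) = G t ∧ ‖G t - a‖ ≤ δ / 2 := by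
    intro t ht
    obtain ⟨-, w, hw, hwf⟩ := hIcc ht
    rw [mem_closedBall, dist_eq_norm] at hw
    change (w : Sphere) = f t at hwf
    simp only [hG]
    rw [← hwf]
    exact ⟨rfl, hw⟩
  have hGz : ∀ z, s ≤ ‖z‖ → ‖z‖ ≤ r → f z = G z ∧ ‖G ‖z‖ - G z‖ < δ / 64 := by
    intro z hz hz'
    have hz0 : 0 < ‖z‖ := hs0.trans_le hz
    obtain ⟨h1, h2⟩ := hGt ‖z‖ ⟨hz, hz'⟩
    obtain ⟨w, hw, hwG⟩ := hcirc (‖z‖ : ℝ) z (ne0 _ hz0) (by rw [nrm _ hz0]; linarith)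
      (nrm _ hz0).symm _ h1 (by linarith)
    have : G z = w := by simp only [hG]; rw [hw]; rfl
    rw [this]
    exact ⟨hw, hwG⟩
  have hGd : ∀ z, s ≤ ‖z‖ → ‖z‖ ≤ r → DifferentiableAt ℂ G z := fun z hz hz' =>
    differentiableAt_finitePart_comp
      (hf z ⟨by simpa using hz'.trans_lt hr1, norm_pos_iff.1 (hs0.trans_le hz)⟩)
      (by rw [(hGz z hz hz').1]; exact OnePoint.coe_ne_infty _)
  have hsIcc : s ∈ Icc s r := ⟨le_rfl, hsr⟩
  have hGs : ‖G s - a‖ = δ / 2 := by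
    refine (hGt s hsIcc).2.antisymm (not_lt.1 fun hlt => hsE ⟨G s, ?_, (hGt s hsIcc).1.symm⟩)
    rwa [mem_ball, dist_eq_norm]
  have hGr : ‖G r - a‖ < δ / 32 := by
    have : G r = wr := by simp only [hG]; rw [hwr]; rfl
    rwa [this]
  have hGcont : ContinuousOn (fun t : ℝ => ‖G t - a‖) (Icc s r) := fun t ht => by
    have ht0 : 0 < t := hs0.trans_le ht.1
    have h1 : ContinuousAt (fun t : ℝ => G t) t :=
      ContinuousAt.comp (f := fun t : ℝ => (t : ℂ)) (hGd t (by rw [nrm t ht0]; exact ht.1)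
        (by rw [nrm t ht0]; exact ht.2)).continuousAt Complex.continuous_ofReal.continuousAt
    exact ContinuousAt.continuousWithinAt (h1.sub continuousAt_const).norm
  obtain ⟨t, ht, htG⟩ := intermediate_value_Icc' hsr hGcont
    (show δ / 4 ∈ Icc ‖G r - a‖ ‖G s - a‖ from ⟨by linarith, by linarith⟩)
  have ht0 : 0 < t := hs0.trans_le ht.1
  -- The product is at most `3 δ² / 64` on both circles, but `δ² / 16` or more at `t`.
  have hmax := norm_le_of_norm_le_on_circles (f := fun z => (G z - a) * (G z - G s)) (r := r)
    (s := s) (C := 3 * δ ^ 2 / 64) (z := t)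
    (fun z hz hz' => ((hGd z hz hz').sub_const a).mul ((hGd z hz hz').sub_const _))
    (fun z hz => by
      have h1 := (hGz z (by linarith) hz.le).2
      rw [hz] at h1
      have h2 := norm_sub_le_norm_sub_add_norm_sub (G z) (G r) a
      have h3 := norm_sub_le_norm_sub_add_norm_sub (G z) a (G s)
      rw [norm_sub_rev (G z) (G r)] at h2
      rw [norm_sub_rev a (G s)] at h3
      rw [norm_mul]
      calc _ ≤ (3 * δ / 64) * δ := by gcongr <;> linarith
        _ = 3 * δ ^ 2 / 64 := by ring)
    (fun z hz => by
      have h1 := (hGz z hz.ge (by linarith)).2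
      rw [hz] at h1
      have h2 := norm_sub_le_norm_sub_add_norm_sub (G z) (G s) a
      rw [norm_sub_rev (G z) (G s)] at h2
      rw [norm_mul, norm_sub_rev (G z) (G s)]
      calc _ ≤ δ * (3 * δ / 64) := by gcongr <;> linarith
        _ = 3 * δ ^ 2 / 64 := by ring)
    (by rw [nrm t ht0]; exact ht.1) (by rw [nrm t ht0]; exact ht.2)
  have htc : δ / 4 ≤ ‖G t - G s‖ := by
    have h2 := norm_sub_le_norm_sub_add_norm_sub (G s) (G t) a
    rw [norm_sub_rev (G s) (G t)] at h2
    simp only at htG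
    linarith
  simp only at htG
  rw [norm_mul, htG] at hmax
  nlinarith

/-! ### Normal families -/

/-- Sequential form of the equicontinuity of a normal family at the point `p`. -/
theorem IsNormalFamily.exists_chi_lt {S : Type} [TopologicalSpace S] [ChartedSpace ℂ S]
    {F : Set (HolMap S)} (hF : IsNormalFamily F) {h : ℕ → HolMap S} (hh : ∀ n, h n ∈ F)
    {q : ℕ → S} {p : S} (hq : Tendsto q atTop (𝓝 p)) {ε : ℝ} (hε : 0 < ε) :
    ∃ n, chi (h n (q n)) (h n p) < ε := by
  obtain ⟨k, g, hk, hg⟩ := hF h hh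
  -- Uniform convergence on this compact set suffices to compare the values at `q n` and `p`.
  set K : Set S := insert p (range q) with hK
  have hKc : IsCompact K := hq.isCompact_insert_range
  have hpK : p ∈ K := mem_insert _ _
  have hqK : ∀ n, q n ∈ K := fun n => mem_insert_of_mem _ (mem_range_self n)
  have hunif : TendstoUniformlyOn (fun n x => stereo (h (k n) x)) (fun x => stereo (g x))
      atTop K := by
    rw [Metric.tendstoUniformlyOn_iff]
    intro ε hε
    obtain ⟨N, hN⟩ := hg K hKc ε hε
    filter_upwards [eventually_ge_atTop N] with n hn x hx
    rw [← chi_eq_dist, chi_comm]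
    exact hN n hn x hx
  have hcont : ContinuousOn (fun x => stereo (g x)) K := hunif.continuousOn
    (Eventually.of_forall fun n =>
      (continuous_stereo.comp (h (k n)).2.continuous).continuousOn).frequently
  have hlim : Tendsto (fun n => stereo (g (q (k n)))) atTop (𝓝 (stereo (g p))) :=
    (hcont p hpK).tendsto.comp (tendsto_nhdsWithin_iff.2
      ⟨hq.comp hk.tendsto_atTop, Eventually.of_forall fun n => hqK _⟩)
  obtain ⟨N, hN⟩ := hg K hKc (ε / 3) (by positivity)
  obtain ⟨n, hn, hn'⟩ := ((eventually_ge_atTop N).and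
    (Metric.tendsto_nhds.1 hlim (ε / 3) (by positivity))).exists
  rw [← chi_eq_dist] at hn'
  refine ⟨k n, ?_⟩
  have h1 := hN n hn (q (k n)) (hqK _)
  have h2 := hN n hn p hpK
  have h3 := chi_triangle (h (k n) (q (k n))) (g (q (k n))) (h (k n) p)
  have h4 := chi_triangle (g (q (k n))) (g p) (h (k n) p)
  rw [chi_comm (g p)] at h4
  linarith

/-! ### Open subsets of the plane as Riemann surfaces -/

theorem mdifferentiableAt_iff_comp_val {U : Opens ℂ} (f : ℂ → Sphere) (x : U) :
    MDifferentiableAt 𝓘(ℂ) 𝓘(ℂ) f x ↔ MDifferentiableAt 𝓘(ℂ) 𝓘(ℂ) (f ∘ Subtype.val) x :=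
  differentiableWithinAt_localInvariantProp.liftPropAt_iff_comp_subtype_val f x

/-- In the charts of open subsets of the plane, a map induced by `e : ℂ → ℂ` is `e` itself. -/
theorem writtenInExtChartAt_opens_eventuallyEq {U V : Opens ℂ} {e : ℂ → ℂ} (φ : U → V)
    (hφ : ∀ z, (φ z : ℂ) = e z) (x : U) :
    writtenInExtChartAt 𝓘(ℂ) 𝓘(ℂ) x φ =ᶠ[𝓝 (x : ℂ)] e := by
  have h := U.chartAt_subtype_val_symm_eventuallyEq (H := ℂ) (x := x)
  change _ =ᶠ[𝓝 (x : ℂ)] _ at h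
  filter_upwards [h] with w hw
  change (φ ((chartAt ℂ x).symm w) : ℂ) = e w
  rw [hφ]
  exact congrArg e hw.symm

theorem mdifferentiableAt_opens {U V : Opens ℂ} {e : ℂ → ℂ} (φ : U → V)
    (hφ : ∀ z, (φ z : ℂ) = e z) (x : U) (he : DifferentiableAt ℂ e x) :
    MDifferentiableAt 𝓘(ℂ) 𝓘(ℂ) φ x := by
  rw [mdifferentiableAt_iff]
  constructor
  · rw [Topology.IsInducing.subtypeVal.continuousAt_iff]
    exact (he.continuousAt.comp continuous_subtype_val.continuousAt).congr
      (Eventually.of_forall fun z => (hφ z).symm)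
  · exact (he.congr_of_eventuallyEq
      (writtenInExtChartAt_opens_eventuallyEq φ hφ x)).differentiableWithinAt

theorem mfderiv_opens_ne_zero {U V : Opens ℂ} {e : ℂ → ℂ} {e' : ℂ} (φ : U → V)
    (hφ : ∀ z, (φ z : ℂ) = e z) (x : U) (he : HasDerivAt e e' x) (he' : e' ≠ 0) :
    mfderiv 𝓘(ℂ) 𝓘(ℂ) φ x ≠ 0 := by
  intro h
  rw [(mdifferentiableAt_opens φ hφ x he.differentiableAt).mfderiv] at h
  have h1 : fderivWithin ℂ (writtenInExtChartAt 𝓘(ℂ) 𝓘(ℂ) x φ) (range 𝓘(ℂ))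
      (extChartAt 𝓘(ℂ) x x) = fderiv ℂ e x := by
    rw [ModelWithCorners.range_eq_univ, fderivWithin_univ]
    exact (writtenInExtChartAt_opens_eventuallyEq φ hφ x).fderiv_eq
  rw [h1] at h
  have h2 : fderiv ℂ e x 1 = 0 := by rw [h]; rfl
  rw [fderiv_apply_one_eq_deriv, he.deriv] at h2
  exact he' h2

instance : ConnectedSpace disc :=
  isConnected_iff_connectedSpace.1
    ((convex_ball (0 : ℂ) 1).isConnected ⟨0, mem_ball_self one_pos⟩)

/-! ### Extension across the puncture -/

/-- A map on the punctured disc, extended to the plane by the junk value `∞`, so that its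
behaviour at `0` can be expressed by the filter `𝓝[≠] 0` on `ℂ`. -/
noncomputable def extendPlane (f : HolMap puncturedDisc) : ℂ → Sphere :=
  Function.extend Subtype.val f fun _ => OnePoint.infty

theorem extendPlane_coe (f : HolMap puncturedDisc) (z : puncturedDisc) :
    extendPlane f z = f z := Subtype.val_injective.extend_apply _ _ _

theorem mdifferentiableAt_extendPlane (f : HolMap puncturedDisc) (z : ℂ)
    (hz : z ∈ ball (0 : ℂ) 1 \ {0}) : MDifferentiableAt 𝓘(ℂ) 𝓘(ℂ) (extendPlane f) z := by
  refine (mdifferentiableAt_iff_comp_val (U := puncturedDisc) (extendPlane f) ⟨z, hz⟩).2 ?_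
  have : extendPlane f ∘ Subtype.val = f.1 := funext (extendPlane_coe f)
  rw [this]
  exact f.2 _

theorem extends_of_tendsto (f : HolMap puncturedDisc) {p : Sphere}
    (hp : Tendsto (extendPlane f) (𝓝[≠] 0) (𝓝 p)) :
    ¬ HasEssentialSingularity f ∧ ExtendsToDisc f := by
  have hopen : IsOpen (ball (0 : ℂ) 1 \ {0}) := isOpen_ball.sdiff isClosed_singleton
  constructor
  · refine not_not.2 ⟨p, ?_⟩
    have h := hp.comp (tendsto_comap (f := (Subtype.val : puncturedDisc → ℂ)) (x := 𝓝[≠] 0))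
    rwa [show extendPlane f ∘ Subtype.val = f.1 from funext (extendPlane_coe f)] at h
  · have hF : ∀ z ∈ ball (0 : ℂ) 1,
        MDifferentiableAt 𝓘(ℂ) 𝓘(ℂ) (Function.update (extendPlane f) 0 p) z := by
      intro z hz
      by_cases h0 : z = 0
      · subst h0
        refine mdifferentiableAt_update_of_tendsto ?_ hp
        filter_upwards [self_mem_nhdsWithin,
          mem_nhdsWithin_of_mem_nhds (ball_mem_nhds (0 : ℂ) one_pos)] with z h1 h2
        exact mdifferentiableAt_extendPlane f z ⟨h2, h1⟩
      · refine (mdifferentiableAt_extendPlane f z ⟨hz, h0⟩).congr_of_eventuallyEq ?_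
        filter_upwards [isOpen_ne.mem_nhds h0] with w hw
        exact Function.update_of_ne hw _ _
    refine ⟨⟨Function.update (extendPlane f) 0 p ∘ Subtype.val, fun z =>
      (mdifferentiableAt_iff_comp_val (U := disc) _ z).1 (hF z z.2)⟩, fun z => ?_⟩
    exact (Function.update_of_ne z.2.2 _ _).trans (extendPlane_coe f z)

/-! ### Compact properties -/

/-- The values of a map with a compact property on a small circle around the puncture are close
to each other. -/
theorem exists_circle_oscillation_lt {P : SphereProperty} (hP : IsCompactProperty P)
    {f : HolMap puncturedDisc} (hf : f ∈ P puncturedDisc) {ε : ℝ} (hε : 0 < ε) :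
    ∃ ρ > 0, ∀ z z' : ℂ, z ≠ 0 → ‖z‖ < ρ → ‖z'‖ = ‖z‖ →
      chi (extendPlane f z) (extendPlane f z') < ε := by
  by_contra! hcon
  choose z z' hz hzρ hzz' hchi using fun n : ℕ => hcon (Real.exp (-(4 * (n + 2)))) (Real.exp_pos _)
  choose u hu hzu using fun n => exists_eq_exp_mul_of_norm_eq (hz n) (hzz' n)
  have hR : ∀ n : ℕ, (Complex.log (z n)).re < -(4 * (n + 2)) := fun n => by
    rw [Complex.log_re]
    exact (Real.log_lt_iff_lt_exp (norm_pos_iff.2 (hz n))).2 (hzρ n)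
  set R : ℕ → ℝ := fun n => 4 * (n + 2) with hRdef
  have hR0 : ∀ n, 0 < R n := fun n => by positivity
  -- A radius `R n → ∞` for which the disc of radius `R n` around `log (z n)` stays in the left
  -- half plane; `z n` and `z' n` are the images of `0` and of `u n / R n`, which tends to `0`.
  set e : ℕ → ℂ → ℂ := fun n ζ => Complex.exp (Complex.log (z n) + R n * ζ) with he
  have hmem : ∀ n, ∀ ζ : disc, e n ζ ∈ puncturedDisc := by
    intro n ζ
    refine ⟨?_, Complex.exp_ne_zero _⟩
    have h1 : ‖(ζ : ℂ)‖ < 1 := by simpa using mem_ball_zero_iff.1 ζ.2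
    have h2 := (Complex.re_le_norm (ζ : ℂ))
    rw [mem_ball_zero_iff, he, Complex.norm_exp, Real.exp_lt_one_iff, Complex.add_re,
      Complex.re_ofReal_mul]
    have h3 := hR n
    have h4 := mul_le_mul_of_nonneg_left (h2.trans h1.le) (hR0 n).le
    simp only [hRdef] at h4 ⊢
    linarith
  have hder : ∀ n ζ, HasDerivAt (e n) (e n ζ * R n) ζ := fun n ζ => by
    simpa using (((hasDerivAt_id ζ).const_mul (R n : ℂ)).const_add (Complex.log (z n))).cexp
  set φ : ℕ → disc → puncturedDisc := fun n ζ => ⟨e n ζ, hmem n ζ⟩ with hφ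
  have hφd : ∀ n, MDifferentiable 𝓘(ℂ) 𝓘(ℂ) (φ n) := fun n ζ =>
    mdifferentiableAt_opens (φ n) (fun _ => rfl) ζ (hder n ζ).differentiableAt
  have hh : ∀ n, f.comp (φ n) (hφd n) ∈ P disc := fun n =>
    hP.comp_mem disc puncturedDisc (φ n) (hφd n) (fun ζ =>
      mfderiv_opens_ne_zero (φ n) (fun _ => rfl) ζ (hder n ζ)
        (mul_ne_zero (Complex.exp_ne_zero _) (Complex.ofReal_ne_zero.2 (hR0 n).ne'))) f hf
  have hun : ∀ n, ‖u n / R n‖ ≤ 1 / ((n : ℝ) + 2) := fun n => by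
    rw [norm_div, Complex.norm_real, Real.norm_of_nonneg (hR0 n).le,
      div_le_div_iff₀ (hR0 n) (by positivity), one_mul]
    simp only [hRdef]
    nlinarith [hu n]
  have hq : ∀ n, u n / R n ∈ disc := fun n => by
    refine mem_ball_zero_iff.2 ((hun n).trans_lt ?_)
    rw [div_lt_one (by positivity)]
    have : (0 : ℝ) ≤ n := n.cast_nonneg
    linarith
  have h0 : (0 : ℂ) ∈ disc := mem_ball_self one_pos
  have hlim : Tendsto (fun n => (⟨u n / R n, hq n⟩ : disc)) atTop (𝓝 ⟨0, h0⟩) := by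
    rw [tendsto_subtype_rng]
    refine squeeze_zero_norm hun ?_
    exact tendsto_const_nhds.div_atTop
      (tendsto_atTop_add_const_right _ _ tendsto_natCast_atTop_atTop)
  obtain ⟨n, hn⟩ := (hP.normal disc).exists_chi_lt hh hlim hε
  have h1 : f.comp (φ n) (hφd n) ⟨0, h0⟩ = extendPlane f (z n) := by
    change f (φ n ⟨0, h0⟩) = _
    rw [← extendPlane_coe]
    simp [hφ, he, Complex.exp_log (hz n)]
  have h2 : f.comp (φ n) (hφd n) ⟨u n / R n, hq n⟩ = extendPlane f (z' n) := by
    change f (φ n ⟨u n / R n, hq n⟩) = _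
    rw [← extendPlane_coe, hzu n]
    simp only [hφ, he]
    rw [mul_div_cancel₀ _ (Complex.ofReal_ne_zero.2 (hR0 n).ne'), Complex.exp_add,
      Complex.exp_log (hz n), mul_comm]
  rw [h1, h2, chi_comm] at hn
  exact absurd hn (not_lt.2 (hchi n))

/-! ### The great Picard theorem for maps into the sphere -/

/-- The coordinate `1 / (z - a)` on `(ℂ ∪ {∞}) \ {a}`, with value `0` at `∞` (and junk value `0`
at `a`). -/
noncomputable def invSubFinitePart (a : ℂ) (p : Sphere) : ℂ := p.elim 0 fun w => (w - a)⁻¹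

theorem invSubFinitePart_infty (a : ℂ) : invSubFinitePart a OnePoint.infty = 0 := rfl

theorem invSubFinitePart_coe (a w : ℂ) : invSubFinitePart a w = (w - a)⁻¹ := rfl

/-- `p = a + 1 / w` for the coordinate `w = 1 / (p - a)`. -/
theorem map_add_invToSphere_invSubFinitePart {a : ℂ} {p : Sphere} (hp : p ≠ a) :
    OnePoint.map (· + a) (invToSphere (invSubFinitePart a p)) = p := by
  induction p using OnePoint.rec with
  | infty => rw [invSubFinitePart_infty, invToSphere_zero, OnePoint.map_infty]
  | coe w =>
    have hw : w - a ≠ 0 := sub_ne_zero.2 fun h => hp (by rw [h])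
    rw [invSubFinitePart_coe, invToSphere_of_ne (inv_ne_zero hw), OnePoint.map_some, inv_inv,
      sub_add_cancel]

theorem invSubFinitePart_eq_div {a : ℂ} {p : Sphere} (hp : p ≠ ((0 : ℂ) : Sphere)) :
    invSubFinitePart a p = invFinitePart p / (1 - a * invFinitePart p) := by
  induction p using OnePoint.rec with
  | infty => simp [invSubFinitePart_infty]
  | coe w =>
    have hw : w ≠ 0 := fun h => hp (by rw [h])
    rw [invSubFinitePart_coe, invFinitePart_coe, show 1 - a * w⁻¹ = (w - a) * w⁻¹ by field_simp,
      div_mul_cancel_right₀ (inv_ne_zero hw)]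

theorem differentiableAt_invSubFinitePart_comp {f : ℂ → Sphere} {a z : ℂ}
    (hf : MDifferentiableAt 𝓘(ℂ) 𝓘(ℂ) f z) (hz : f z ≠ a) :
    DifferentiableAt ℂ (fun z => invSubFinitePart a (f z)) z := by
  by_cases hi : f z = OnePoint.infty
  · have hne : f z ≠ ((0 : ℂ) : Sphere) := by rw [hi]; exact OnePoint.infty_ne_coe 0
    have hv := differentiableAt_invFinitePart_comp hf hne
    refine (hv.div ((differentiableAt_const 1).sub (hv.const_mul a))
      (by simp [hi])).congr_of_eventuallyEq ?_
    filter_upwards [hf.continuousAt.eventually_ne hne] with w hw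
    exact invSubFinitePart_eq_div hw
  · have hv := differentiableAt_finitePart_comp hf hi
    refine ((hv.sub_const a).inv (sub_ne_zero.2 fun h => hz ?_)).congr_of_eventuallyEq ?_
    · rw [← h, coe_finitePart hi]
    · filter_upwards [hf.continuousAt.eventually_ne hi] with w hw
      conv_lhs => rw [← coe_finitePart hw]
      rfl

/-- The great Picard theorem for maps omitting three points of the sphere, one of which is finite
and is sent to `∞` by the coordinate `1 / (z - a)`. -/
theorem great_picard_sphere_of_omits_coe {f : ℂ → Sphere} {a : ℂ} {b c : Sphere} (hba : b ≠ a)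
    (hca : c ≠ a) (hbc : b ≠ c)
    (hf : ∀ z ∈ ball (0 : ℂ) 1 \ {0}, MDifferentiableAt 𝓘(ℂ) 𝓘(ℂ) f z)
    (ha : ∀ z ∈ ball (0 : ℂ) 1 \ {0}, f z ≠ a) (hb : ∀ z ∈ ball (0 : ℂ) 1 \ {0}, f z ≠ b)
    (hc : ∀ z ∈ ball (0 : ℂ) 1 \ {0}, f z ≠ c) :
    ∃ p, Tendsto f (𝓝[≠] 0) (𝓝 p) := by
  have hinj : ∀ p q : Sphere, p ≠ a → q ≠ a → p ≠ q →
      invSubFinitePart a p ≠ invSubFinitePart a q := fun p q hp hq hpq h => hpq (by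
    rw [← map_add_invToSphere_invSubFinitePart hp, h, map_add_invToSphere_invSubFinitePart hq])
  have hT : Continuous (OnePoint.map (· + a)) := (Homeomorph.addRight a).onePointCongr.continuous
  have hfT : (fun z => OnePoint.map (· + a) (invToSphere (invSubFinitePart a (f z))))
      =ᶠ[𝓝[≠] 0] f := by
    filter_upwards [self_mem_nhdsWithin,
      mem_nhdsWithin_of_mem_nhds (ball_mem_nhds (0 : ℂ) one_pos)] with z h1 h2
    exact map_add_invToSphere_invSubFinitePart (ha z ⟨h2, h1⟩)
  suffices ∃ p, Tendsto (fun z => invToSphere (invSubFinitePart a (f z))) (𝓝[≠] 0) (𝓝 p) by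
    obtain ⟨p, hp⟩ := this
    exact ⟨_, ((hT.tendsto p).comp hp).congr' hfT⟩
  rcases great_picard_of_omits (f := fun z => invSubFinitePart a (f z)) (hinj b c hba hca hbc)
    (fun z hz => (differentiableAt_invSubFinitePart_comp (hf z hz)
      (ha z hz)).differentiableWithinAt)
    (fun z hz => hinj _ _ (ha z hz) hba (hb z hz)) (fun z hz => hinj _ _ (ha z hz) hca (hc z hz))
    with ⟨w, hw⟩ | hw
  · exact ⟨_, (continuous_invToSphere.tendsto w).comp hw⟩
  · refine ⟨((0 : ℂ) : Sphere), ?_⟩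
    have h1 := (OnePoint.continuous_coe.tendsto (0 : ℂ)).comp (tendsto_inv₀_cobounded.comp hw)
    refine h1.congr' ?_
    filter_upwards [hw.eventually (Bornology.eventually_ne_cobounded (0 : ℂ))] with z hz
    exact (invToSphere_of_ne hz).symm

/-- The **great Picard theorem** for maps into the sphere. -/
theorem great_picard_sphere {f : ℂ → Sphere} {X : Set Sphere} (hX : 3 ≤ X.encard)
    (hf : ∀ z ∈ ball (0 : ℂ) 1 \ {0}, MDifferentiableAt 𝓘(ℂ) 𝓘(ℂ) f z)
    (hfX : ∀ z ∈ ball (0 : ℂ) 1 \ {0}, f z ∉ X) : ∃ p, Tendsto f (𝓝[≠] 0) (𝓝 p) := by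
  obtain ⟨Y, hYX, hY⟩ := exists_subset_encard_eq hX
  obtain ⟨a, b, c, hab, hac, hbc, rfl⟩ := encard_eq_three.1 hY
  have hne : ∀ x ∈ ({a, b, c} : Set Sphere), ∀ z ∈ ball (0 : ℂ) 1 \ {0}, f z ≠ x :=
    fun x hx z hz h => hfX z hz (h ▸ hYX hx)
  induction a using OnePoint.rec with
  | infty =>
    induction b using OnePoint.rec with
    | infty => exact absurd rfl hab
    | coe b =>
      exact great_picard_sphere_of_omits_coe hab hbc.symm hac hf (hne _ (by simp)) (hne _ (by simp))
        (hne _ (by simp))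
  | coe a =>
    exact great_picard_sphere_of_omits_coe hab.symm hac.symm hbc hf (hne _ (by simp))
      (hne _ (by simp)) (hne _ (by simp))

end BlochRos

theorem proposition2p5 :
    (∀ P : BlochRos.SphereProperty, BlochRos.IsCompactProperty P →
      ∀ f ∈ P BlochRos.puncturedDisc,
        ¬ BlochRos.HasEssentialSingularity f ∧ BlochRos.ExtendsToDisc f) ∧
    (∀ X : Set BlochRos.Sphere, 3 ≤ X.encard →
      ∀ f ∈ BlochRos.omitProperty X BlochRos.puncturedDisc,
        ¬ BlochRos.HasEssentialSingularity f ∧ BlochRos.ExtendsToDisc f) := by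
  constructor
  · intro P hP f hf
    obtain ⟨p, hp⟩ := BlochRos.exists_tendsto_of_circle_oscillation
      (BlochRos.mdifferentiableAt_extendPlane f)
      fun ε hε => BlochRos.exists_circle_oscillation_lt hP hf hε
    exact BlochRos.extends_of_tendsto f hp
  · intro X hX f hf
    obtain ⟨p, hp⟩ : ∃ p, Tendsto (BlochRos.extendPlane f) (𝓝[≠] 0) (𝓝 p) := by
      rcases hf with hf | ⟨c, hc⟩
      · refine BlochRos.great_picard_sphere hX (BlochRos.mdifferentiableAt_extendPlane f)
          fun z hz => ?_
        rw [BlochRos.extendPlane_coe f ⟨z, hz⟩]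
        exact hf _
      · refine ⟨c, tendsto_const_nhds.congr' ?_⟩
        filter_upwards [self_mem_nhdsWithin,
          mem_nhdsWithin_of_mem_nhds (Metric.ball_mem_nhds (0 : ℂ) one_pos)] with z h1 h2
        rw [BlochRos.extendPlane_coe f ⟨z, h2, h1⟩]
        exact (hc _).symm
    exact BlochRos.extends_of_tendsto f hp
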